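/- Let a finite relational database schema be fixed: finitely many relation names, each with finitely many attributes, where every attribute is typed and takes values either in a domain $D$ of constants or in a numeric domain $N$, with $D$ and $N$ disjoint and their elements named by binary strings (distinct elements of $D$, and likewise of $N$, by distinct strings). A database instance assigns to each relation name a finite set of tuples of the appropriate arity and types; $\Sigma(r)$ denotes the set of facts $P(\bar a)$ of the instance $r$. A functional dependency (FD) $X\to Y$ over a relation $P$ says that any two tuples of $P$ that agree on the attributes in $X$ agree on the attributes in $Y$; an inclusion dependency (IND) $Q[Y]\subseteq P[X]$, where $Y$ and $X$ are sequences of distinct attributes of $Q$ and $P$ of the same length, says that for every tuple $s$ of $Q$ there is a tuple $t$ of $P$ with $t[X]=s[Y]$. A set $I$ of INDs is acyclic if the directed graph on the relation names with an edge from $Q$ to $P$ whenever $I$ contains an IND of the form $Q[Y]\subseteq P[X]$ has no directed cycle (loops count as cycles). An instance $r'$ is a repair of an instance $r$ with respect to a set $IC$ of constraints if $\Sigma(r')\subseteq\Sigma(r)$, $r'$ satisfies $IC$, and $\Sigma(r)\setminus\Sigma(r')$ is minimal with respect to inclusion among the sets $\Sigma(r)\setminus\Sigma(r'')$, where $r''$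 ranges over the instances with $\Sigma(r'')\subseteq\Sigma(r)$ that satisfy $IC$. Theorem. Let $IC=F\cup I$ be a fixed set of constraints consisting of a set $F$ of FDs and an acyclic set $I$ of INDs over the schema. Then the repair checking problem $$B_{IC}=\{(r,r') : r' \text{ is a repair of } r \text{ with respect to } IC\}$$ is in PTIME: there is a deterministic Turing machine that, given any two database instances $r$ and $r'$, written as lists of their facts, decides in time polynomial in the length of the input whether $(r,r')\in B_{IC}$. -/

import Mathlib

/-! ## Relational schemas and database instances -/

/-- The two kinds of attributes: uninterpreted constants and numbers. -/
inductive AttrType where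
  | dom
  | num

/-- A database schema: finitely many relation names, each with finitely many typed attributes. -/
structure Schema where
  Rel : Type
  [finRel : Fintype Rel]
  arity : Rel → ℕ
  attrType : (P : Rel) → Fin (arity P) → AttrType

attribute [instance] Schema.finRel

/-- Elements of the disjoint union of the database domain `D` and the numeric domain `N`
that may occur under an attribute of the given type. -/
def AttrType.Allows {D N : Type} : AttrType → D ⊕ N → Prop
  | .dom, .inl _ => True
  | .num, .inr _ => True
  | _, _ => False

/-- The tuples over a relation `P`. -/
def DBTuple (S : Schema) (D N : Type) (P : S.Rel) : Type :=
  {t : Fin (S.arity P) → D ⊕ N // ∀ i, (S.attrType P i).Allows (t i)}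

/-- A fact `P(a₁, …, aₖ)`. -/
def DBFact (S : Schema) (D N : Type) : Type :=
  (P : S.Rel) × DBTuple S D N P

/-- A database instance: every relation name is interpreted by a finite set of tuples. -/
structure DBInstance (S : Schema) (D N : Type) where
  tuples : (P : S.Rel) → Set (DBTuple S D N P)
  finite_tuples : ∀ P, (tuples P).Finite

/-- The set of facts of an instance. -/
def DBInstance.facts {S : Schema} {D N : Type} (r : DBInstance S D N) : Set (DBFact S D N) :=
  {f | f.2 ∈ r.tuples f.1}

/-! ## Integrity constraints -/

/-- A functional dependency `X → Y` over the relation `P`. -/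
structure FD (S : Schema) where
  P : S.Rel
  X : Finset (Fin (S.arity P))
  Y : Finset (Fin (S.arity P))

/-- An inclusion dependency `Q[Y] ⊆ P[X]`, where `Y` and `X` are sequences of distinct attributes
of `Q` and `P`, of the same length. -/
structure IND (S : Schema) where
  Q : S.Rel
  P : S.Rel
  length : ℕ
  Y : Fin length → Fin (S.arity Q)
  X : Fin length → Fin (S.arity P)
  Y_distinct : Function.Injective Y
  X_distinct : Function.Injective X

/-- The functional dependency `φ` is true in `r`. -/
def FD.Holds {S : Schema} {D N : Type} (φ : FD S) (r : DBInstance S D N) : Prop :=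
  ∀ s ∈ r.tuples φ.P, ∀ t ∈ r.tuples φ.P,
    (∀ i ∈ φ.X, s.1 i = t.1 i) → ∀ i ∈ φ.Y, s.1 i = t.1 i

/-- The inclusion dependency `φ` is true in `r`. -/
def IND.Holds {S : Schema} {D N : Type} (φ : IND S) (r : DBInstance S D N) : Prop :=
  ∀ s ∈ r.tuples φ.Q, ∃ t ∈ r.tuples φ.P, ∀ j, t.1 (φ.X j) = s.1 (φ.Y j)

/-- Integrity constraints: functional and inclusion dependencies. -/
inductive Constraint (S : Schema) where
  | fd (φ : FD S)
  | ind (φ : IND S)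

/-- The constraint is true in `r`. -/
def Constraint.Holds {S : Schema} {D N : Type} : Constraint S → DBInstance S D N → Prop
  | .fd φ, r => φ.Holds r
  | .ind φ, r => φ.Holds r

/-- `r` is consistent with respect to `IC`. -/
def DBInstance.Consistent {S : Schema} {D N : Type} (r : DBInstance S D N)
    (IC : Set (Constraint S)) : Prop :=
  ∀ c ∈ IC, c.Holds r

/-- The edges of the graph of a set of inclusion dependencies: from `Q` to `P` if there is an
inclusion dependency of the form `Q[Y] ⊆ P[X]` in `I`. -/
def INDEdge {S : Schema} (I : Set (IND S)) (Q P : S.Rel) : Prop :=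
  ∃ φ ∈ I, φ.Q = Q ∧ φ.P = P

/-- The graph of `I` has no (directed) cycle; a loop counts as a cycle. -/
def AcyclicINDs {S : Schema} (I : Set (IND S)) : Prop :=
  ∀ P : S.Rel, ¬ Relation.TransGen (INDEdge I) P P

/-! ## Repairs -/

/-- The distance `Δ⁻(r, r')`: the facts of `r` that are missing in `r'`. -/
def deltaMinus {S : Schema} {D N : Type} (r r' : DBInstance S D N) : Set (DBFact S D N) :=
  r.facts \ r'.facts

/-- `r' ≤_r r''`. -/
def CloserTo {S : Schema} {D N : Type} (r r' r'' : DBInstance S D N) : Prop :=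
  deltaMinus r r' ⊆ deltaMinus r r''

/-- `r'` is a repair of `r` with respect to `IC`: it is obtained from `r` by deletions only, is
consistent, and is `≤_r`-minimal among the consistent instances obtained from `r` by deletions. -/
def IsRepair {S : Schema} {D N : Type} (IC : Set (Constraint S)) (r r' : DBInstance S D N) :
    Prop :=
  (r'.facts ⊆ r.facts ∧ r'.Consistent IC) ∧
    ∀ r'' : DBInstance S D N, r''.facts ⊆ r.facts → r''.Consistent IC →
      CloserTo r r'' r' → CloserTo r r' r''

/-- The repair checking problem `B_IC`. -/
def repairChecking (S : Schema) (D N : Type) (IC : Set (Constraint S)) :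
    Set (DBInstance S D N × DBInstance S D N) :=
  {p | IsRepair IC p.1 p.2}

/-! ## Instances as inputs of Turing machines -/

/-- The instance whose facts are the entries of a list (in any order, possibly repeated). -/
def DBInstance.ofList {S : Schema} {D N : Type} (l : List (DBFact S D N)) : DBInstance S D N where
  tuples P := {t | (⟨P, t⟩ : DBFact S D N) ∈ l}
  finite_tuples P := l.finite_toSet.preimage (f := fun t => (⟨P, t⟩ : DBFact S D N))
    (fun _ _ _ _ h => eq_of_heq (Sigma.mk.inj h).2)

/-- The (finite) input alphabet for a schema: the relation names, the two marks that open a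
constant of either kind, the bits, the mark that ends a constant, and the separator between the
two instances. -/
inductive InputSymbol (S : Schema) where
  | rel (P : S.Rel)
  | dom
  | num
  | bit (b : Bool)
  | close
  | sep

/-- A constant or number is written as a type mark, the binary string that names it, and an end
mark. -/
def encodeValue (S : Schema) {D N : Type} (encD : Computability.Encoding D Bool)
    (encN : Computability.Encoding N Bool) : D ⊕ N → List (InputSymbol S)
  | .inl d => .dom :: (encD.encode d).map .bit ++ [.close]
  | .inr n => .num :: (encN.encode n).map .bit ++ [.close]

/-- A fact is written as its relation name followed by its entries. -/
def encodeFact {S : Schema} {D N : Type} (encD : Computability.Encoding D Bool)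
    (encN : Computability.Encoding N Bool) (f : DBFact S D N) : List (InputSymbol S) :=
  .rel f.1 :: (List.ofFn f.2.1).flatMap (encodeValue S encD encN)

/-- A pair of lists of facts is written as the facts of the first list, the separator, and the
facts of the second list. -/
def encodePair {S : Schema} {D N : Type} (encD : Computability.Encoding D Bool)
    (encN : Computability.Encoding N Bool) (p : List (DBFact S D N) × List (DBFact S D N)) :
    List (InputSymbol S) :=
  p.1.flatMap (encodeFact encD encN) ++ .sep :: p.2.flatMap (encodeFact encD encN)

open Classical in
/-- Membership in `A` is decided in polynomial time (in the length of the encoded input) by a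
deterministic multi-stack Turing machine. -/
def DecidableInPolyTime {α Γ : Type} (enc : α → List Γ) (A : Set α) : Prop :=
  Nonempty (Turing.TM2ComputableInPolyTime enc Computability.encodeBool
    (fun a => decide (a ∈ A)))

/-- `B_IC` is in PTIME, for fixed schema, domains and constraints, when constants and numbers are
named by binary strings through `encD` and `encN`, and instances are given as lists of facts. -/
def RepairCheckingInPTIME (S : Schema) {D N : Type} (encD : Computability.Encoding D Bool)
    (encN : Computability.Encoding N Bool) (IC : Set (Constraint S)) : Prop :=
  DecidableInPolyTime (encodePair encD encN)
    {p : List (DBFact S D N) × List (DBFact S D N) |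
      (DBInstance.ofList p.1, DBInstance.ofList p.2) ∈ repairChecking S D N IC}

/-! Repairs can be recognised locally. Let r' ⊆ r be consistent, and suppose that a consistent r'' ⊆
r properly contains r'. Since the INDs are acyclic, among the relations in which r'' has a fact
outside r' there is one, Q, with no IND from Q into another of them. A single new fact over Q can be
added to r': FDs are inherited from r'', and the witnesses required by the INDs lie in relations
where r'' has nothing beyond r'. So r' is a repair iff r' ⊆ r, r' is consistent, and no single fact
of r \ r' can be added consistently (`isRepair_iff`).

This criterion looks at no more than two facts at a time, and only at their relation names, the
instance they come from and which of their entries are equal (`isRepair_iff_agreements`). It is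
therefore determined by a finite invariant of the input word, `wordType`. This records, for every
nonempty suffix, its first symbol, whether a separator occurs in it, and how its leading fields
agree with those of each nonempty suffix. The schema is fixed, so there are finitely many types: a
type fits into the finite control, and the verdict is a hardwired function of it. Two nested loops
over the suffixes, with linear-time comparisons, find the type in cubic time (`runs_typeProgram`).

Facts and suffixes are matched in `allOn_image_suffixes` and `someOn_image_suffixes`: a suffix that
begins with a relation name begins with an encoded fact. Programs are written in a small structured
language, whose translation to Turing machines is verified once, in `Exec.iterate_next`. -/

/-! ## A structured language for stack programs -/

/-- Structured programs over stacks indexed by `K` with alphabet `A` and finite control `σ`. -/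
inductive StackProg (K A σ : Type) : Type
  /-- Pop a symbol (if any) from `a`, push it on all stacks in `bs`, and update the state. -/
  | move (a : K) (bs : List K) (f : σ → Option A → σ)
  | load (f : σ → σ)
  | seq (p q : StackProg K A σ)
  /-- Repeat `p` as long as the test holds for the state and the top of `a`. -/
  | loop (a : K) (t : σ → Option A → Bool) (p : StackProg K A σ)

namespace StackProg

open Turing Function

variable {K A σ : Type}

/-! ### Continuations and compilation to a multi-stack machine -/

/-- The continuations that occur while running `p` before the continuation `c`. -/
def conts : StackProg K A σ → List (StackProg K A σ) → Set (List (StackProg K A σ))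
  | .move a bs f, c => {.move a bs f :: c}
  | .load f, c => {.load f :: c}
  | .seq p q, c => insert (.seq p q :: c) (conts p (q :: c) ∪ conts q c)
  | .loop a t p, c => insert (.loop a t p :: c) (conts p (.loop a t p :: c))

/-- A loop body runs with the loop itself as continuation, so unrolling a loop creates no new
continuations. Continuations can thus serve as the finitely many labels of a machine. -/
theorem conts_finite (p : StackProg K A σ) (c : List (StackProg K A σ)) : (conts p c).Finite := by
  induction p generalizing c with
  | move => exact Set.finite_singleton _
  | load => exact Set.finite_singleton _
  | seq p q hp hq => exact ((hp _).union (hq _)).insert _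
  | loop a t p hp => exact (hp _).insert _

theorem cons_mem_conts (p : StackProg K A σ) (c : List (StackProg K A σ)) : p :: c ∈ conts p c := by
  cases p <;> simp [conts]

/-- The labels of the compiled program. -/
abbrev Label (p : StackProg K A σ) : Type := {c // c ∈ insert [] (conts p [])}

noncomputable instance (p : StackProg K A σ) : Fintype (Label p) :=
  ((conts_finite p []).insert []).fintype

open Classical in
/-- The label of a continuation. -/
noncomputable def label (p : StackProg K A σ) (c : List (StackProg K A σ)) : Label p :=
  -- The default label is never reached: every jump in a run of `p` leads to a continuation of `p`.
  if h : c ∈ insert [] (conts p []) then ⟨c, h⟩ else ⟨[], Set.mem_insert _ _⟩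

/-- The stack alphabets of the compiled program: an output stack of bits is added. -/
abbrev Alphabet (K A : Type) : Option K → Type
  | none => Bool
  | some _ => A

theorem label_val {p : StackProg K A σ} {c : List (StackProg K A σ)}
    (h : c ∈ insert [] (conts p [])) : (label p c).1 = c := by
  simp only [label, dif_pos h]

/-- The stacks of the compiled program while the output is empty. -/
def withOutput (S : K → List A) : ∀ o, List (Alphabet K A o)
  | none => []
  | some k => S k

@[simp] theorem withOutput_some (S : K → List A) (k : K) : withOutput S (some k) = S k := rfl

variable [DecidableEq K]

/-- Push the symbol `x` on all stacks in `bs`. -/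
def pushOn (x : A) (bs : List K) (S : K → List A) : K → List A :=
  bs.foldl (fun S b => update S b (x :: S b)) S

/-- `Exec p v S n v' S'`: started in state `v` with stacks `S`, the program `p` ends after `n` steps
in state `v'` with stacks `S'`. -/
inductive Exec : StackProg K A σ → σ → (K → List A) → ℕ → σ → (K → List A) → Prop
  | move_nil {a bs f v S} (h : S a = []) : Exec (.move a bs f) v S 1 (f v none) S
  | move_cons {a bs f v S x l} (h : S a = x :: l) :
      Exec (.move a bs f) v S 1 (f v (some x)) (pushOn x bs (update S a l))
  | load {f v S} : Exec (.load f) v S 1 (f v) S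
  | seq {p q v S m v₁ S₁ n v₂ S₂} (hp : Exec p v S m v₁ S₁) (hq : Exec q v₁ S₁ n v₂ S₂) :
      Exec (.seq p q) v S (n + m + 1) v₂ S₂
  | loop_done {a t p v S} (h : t v (S a).head? = false) : Exec (.loop a t p) v S 1 v S
  | loop_step {a t p v S m v₁ S₁ n v₂ S₂} (h : t v (S a).head? = true) (hp : Exec p v S m v₁ S₁)
      (hq : Exec (.loop a t p) v₁ S₁ n v₂ S₂) : Exec (.loop a t p) v S (n + m + 1) v₂ S₂

theorem update_withOutput (S : K → List A) (k : K) (l : List A) :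
    update (withOutput S) (some k) l = withOutput (update S k l) := by
  funext o
  cases o with
  | none => simp [withOutput]
  | some j =>
    by_cases h : j = k
    · subst h; simp
    · simp [h]

variable [Inhabited A]

/-- The statement pushing the recorded symbol on all stacks in `bs`. -/
def pushStmt {Λ : Type} (bs : List K) (q : TM2.Stmt (Alphabet K A) Λ (σ × Option A)) :
    TM2.Stmt (Alphabet K A) Λ (σ × Option A) :=
  -- The default symbol is never pushed: this statement runs only after a successful pop.
  bs.foldr (fun b q => .push (some b) (fun v => (v.2.getD default : A)) q) q

/-- The statement run at a continuation of `p`. When the program is over, the result is put on the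
output stack and the initial state `v₀` is restored. -/
noncomputable def code (p : StackProg K A σ) (v₀ : σ) (result : σ → Bool) :
    List (StackProg K A σ) → TM2.Stmt (Alphabet K A) (Label p) (σ × Option A)
  | [] => .push none (fun v => result v.1) (.load (fun _ => (v₀, none)) .halt)
  | .move a bs f :: c =>
    .pop (some a) (fun v x => (v.1, x)) (.branch (fun v => v.2.isSome)
      (pushStmt bs (.load (fun v => (f v.1 v.2, none)) (.goto fun _ => label p c)))
      (.load (fun v => (f v.1 none, none)) (.goto fun _ => label p c)))
  | .load f :: c => .load (fun v => (f v.1, none)) (.goto fun _ => label p c)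
  | .seq q r :: c => .goto fun _ => label p (q :: r :: c)
  | .loop a t q :: c =>
    .peek (some a) (fun v x => (v.1, x)) (.branch (fun v => t v.1 v.2)
      (.load (fun v => (v.1, none)) (.goto fun _ => label p (q :: .loop a t q :: c)))
      (.load (fun v => (v.1, none)) (.goto fun _ => label p c)))

/-- All pushes of a `move` belong to one machine statement, which is why `Exec` charges a single
step for it. -/
theorem stepAux_pushStmt {Λ : Type} (bs : List K)
    (q : TM2.Stmt (Alphabet K A) Λ (σ × Option A)) (v : σ) (x : A) (S : K → List A) :
    TM2.stepAux (pushStmt bs q) (v, some x) (withOutput S) =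
      TM2.stepAux q (v, some x) (withOutput (pushOn x bs S)) := by
  induction bs generalizing S with
  | nil => rfl
  | cons b bs ih =>
    have h : update (withOutput S) (some b) (x :: S b) = withOutput (update S b (x :: S b)) :=
      update_withOutput S b _
    calc _ = TM2.stepAux (pushStmt bs q) (v, some x)
          (update (withOutput S) (some b) (x :: S b)) := rfl
      _ = _ := by rw [h, ih]; rfl

/-- The configuration of the compiled program before running the continuation `c`. -/
noncomputable def cfg (p : StackProg K A σ) (c : List (StackProg K A σ)) (v : σ)
    (S : K → List A) : TM2.Cfg (Alphabet K A) (Label p) (σ × Option A) :=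
  ⟨some (label p c), (v, none), withOutput S⟩

/-- The transition function of the compiled program. -/
noncomputable abbrev next (p : StackProg K A σ) (v₀ : σ) (result : σ → Bool) :
    TM2.Cfg (Alphabet K A) (Label p) (σ × Option A) →
      Option (TM2.Cfg (Alphabet K A) (Label p) (σ × Option A)) :=
  TM2.step fun l : Label p => code p v₀ result l.1

theorem next_cfg {p : StackProg K A σ} {c : List (StackProg K A σ)}
    (h : c ∈ insert [] (conts p [])) (v₀ : σ) (result : σ → Bool) (v : σ) (S : K → List A) :
    next p v₀ result (cfg p c v S) =
      some (TM2.stepAux (code p v₀ result c) (v, none) (withOutput S)) := by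
  rw [cfg, next, TM2.step, label_val h]

/-- Correctness of the compilation, with exact step counts. The induction runs over subprograms `q`
of `p` under an arbitrary continuation `c`; the two membership hypotheses keep every configuration
on a genuine label. -/
theorem Exec.iterate_next {p q : StackProg K A σ} {v v' : σ} {S S' : K → List A} {n : ℕ}
    (h : Exec q v S n v' S') (v₀ : σ) (result : σ → Bool) (c : List (StackProg K A σ))
    (hc : c ∈ insert [] (conts p [])) (hq : conts q c ⊆ insert [] (conts p [])) :
    (flip bind (next p v₀ result))^[n] (some (cfg p (q :: c) v S)) = some (cfg p c v' S') := by
  have hqc := hq (cons_mem_conts q c)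
  induction h generalizing c with
  | @move_nil a bs f v S h =>
    refine (next_cfg hqc v₀ result v S).trans ?_
    have h' : withOutput S (some a) = [] := h
    simp [code, h', cfg]
  | @move_cons a bs f v S x l h =>
    refine (next_cfg hqc v₀ result v S).trans ?_
    have h' : withOutput S (some a) = x :: l := h
    have hu := update_withOutput S a l
    simp only [code, TM2.stepAux, h', List.head?_cons, List.tail_cons, Option.isSome_some, cond_true]
    rw [hu, stepAux_pushStmt]
    rfl
  | load =>
    exact next_cfg hqc v₀ result _ _
  | @seq p₁ p₂ v S m v₁ S₁ n v₂ S₂ h₁ h₂ ih₁ ih₂ =>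
    have hsub₁ : conts p₁ (p₂ :: c) ⊆ insert [] (conts p []) :=
      fun _ h => hq (Set.mem_insert_of_mem _ (Or.inl h))
    have hsub₂ : conts p₂ c ⊆ insert [] (conts p []) :=
      fun _ h => hq (Set.mem_insert_of_mem _ (Or.inr h))
    have hc₂ := hsub₂ (cons_mem_conts p₂ c)
    have h0 : flip bind (next p v₀ result) (some (cfg p (.seq p₁ p₂ :: c) v S)) =
      some (cfg p (p₁ :: p₂ :: c) v S) := next_cfg hqc v₀ result v S
    rw [iterate_succ_apply, h0, iterate_add_apply,
      ih₁ _ hc₂ hsub₁ (hsub₁ (cons_mem_conts _ _)), ih₂ _ hc hsub₂ hc₂]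
  | @loop_done a t q v S h =>
    refine (next_cfg hqc v₀ result v S).trans ?_
    have h' : t v (withOutput S (some a)).head? = false := h
    simp only [code, TM2.stepAux, h', cond_false]
    rfl
  | @loop_step a t q v S m v₁ S₁ n v₂ S₂ h h₁ h₂ ih₁ ih₂ =>
    have hsub : conts q (.loop a t q :: c) ⊆ insert [] (conts p []) :=
      fun _ h => hq (Set.mem_insert_of_mem _ h)
    have h' : t v (withOutput S (some a)).head? = true := h
    have h0 : flip bind (next p v₀ result) (some (cfg p (.loop a t q :: c) v S)) =
        some (cfg p (q :: .loop a t q :: c) v S) := by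
      refine (next_cfg hqc v₀ result v S).trans ?_
      simp only [code, TM2.stepAux, h', cond_true]
      rfl
    rw [iterate_succ_apply, h0, iterate_add_apply, ih₁ _ hqc hsub (hsub (cons_mem_conts _ _)),
      ih₂ _ hc hq hqc]

/-- The Turing machine of a stack program. -/
noncomputable def machine [Fintype K] [Fintype A] [Fintype σ] (p : StackProg K A σ) (k₀ : K)
    (v₀ : σ) (result : σ → Bool) : FinTM2 where
  K := Option K
  k₀ := some k₀
  k₁ := none
  Γ := Alphabet K A
  Λ := Label p
  main := label p [p]
  σ := σ × Option A
  initialState := (v₀, none)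
  Γk₀Fin := inferInstanceAs (Fintype A)
  m l := code p v₀ result l.1

/-- A problem is decidable in polynomial time if a stack program decides it in polynomial time. -/
theorem decidableInPolyTime [Fintype K] [Fintype A] [Fintype σ] {α : Type} (enc : α → List A)
    (X : Set α) (p : StackProg K A σ) (k₀ : K) (v₀ : σ) (result : σ → Bool) (T : Polynomial ℕ)
    (h : ∀ a, ∃ n ≤ T.eval (enc a).length, ∃ v,
      Exec p v₀ (update (fun _ => []) k₀ (enc a)) n v (fun _ => []) ∧ (result v = true ↔ a ∈ X)) :
    DecidableInPolyTime enc X := by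
  classical
  choose n hn v hv hX using h
  refine ⟨⟨⟨machine p k₀ v₀ result, Equiv.refl A, Equiv.refl Bool⟩, T + 1, fun a => ?_⟩⟩
  -- The additional step is the one at the empty continuation: it writes the answer and restores the
  -- initial state, as the halting configuration requires.
  refine ⟨⟨n a + 1, ?_⟩, by simpa using hn a⟩
  have h₁ : initList (machine p k₀ v₀ result) (List.map (Equiv.refl A).invFun (enc a)) =
      cfg p [p] v₀ (update (fun _ => []) k₀ (enc a)) := by
    simp only [initList, cfg, machine]
    congr 1
    funext o
    cases o with
    | none => rfl
    | some k =>
      by_cases hk : k = k₀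
      · subst hk
        simp [withOutput]
        rfl
      · simp [withOutput, hk]
  have h₂ := (hv a).iterate_next (p := p) v₀ result [] (Set.mem_insert _ _)
    (Set.subset_insert _ _)
  have h₃ := next_cfg (p := p) (Set.mem_insert _ _) v₀ result (v a) (fun _ => [])
  have h₄ : TM2.stepAux (code p v₀ result []) (v a, none) (withOutput fun _ => []) =
      haltList (machine p k₀ v₀ result)
        (List.map (Equiv.refl Bool).invFun (Computability.encodeBool (decide (a ∈ X)))) := by
    have hr : result (v a) = decide (a ∈ X) := by
      rw [Bool.eq_iff_iff, hX a, decide_eq_true_iff]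
    simp only [code, TM2.stepAux, haltList, machine, hr]
    congr 1
    funext o
    cases o with
    | none => simp [withOutput, Computability.encodeBool]; rfl
    | some k => simp [withOutput]
  rw [iterate_succ_apply', h₁]
  refine (congrArg (flip bind _) h₂).trans (h₃.trans ?_)
  rw [h₄]
  rfl

/-! ### Executions with an upper bound on the running time -/

section Runs

variable {K A σ : Type} [DecidableEq K]

/-- The program `p` leads from `v`, `S` to `v'`, `S'` in at most `B` steps. -/
def Runs (p : StackProg K A σ) (v : σ) (S : K → List A) (B : ℕ) (v' : σ) (S' : K → List A) : Prop :=
  ∃ n ≤ B, Exec p v S n v' S'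

theorem Runs.mono {p : StackProg K A σ} {v v' : σ} {S S' : K → List A} {B B' : ℕ}
    (h : Runs p v S B v' S') (hB : B ≤ B') : Runs p v S B' v' S' :=
  let ⟨n, hn, he⟩ := h
  ⟨n, hn.trans hB, he⟩

theorem Runs.conv {p : StackProg K A σ} {v v₁ v₂ : σ} {S S₁ S₂ : K → List A} {B C : ℕ}
    (h : Runs p v S B v₁ S₁) (hB : B ≤ C) (hv : v₁ = v₂) (hS : S₁ = S₂) : Runs p v S C v₂ S₂ :=
  hv ▸ hS ▸ h.mono hB

theorem Runs.load (f : σ → σ) (v : σ) (S : K → List A) : Runs (.load f) v S 1 (f v) S :=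
  ⟨1, le_rfl, .load⟩

theorem Runs.move_cons {a : K} {x : A} {l : List A} {S : K → List A} (h : S a = x :: l)
    (bs : List K) (f : σ → Option A → σ) (v : σ) :
    Runs (.move a bs f) v S 1 (f v (some x)) (pushOn x bs (update S a l)) :=
  ⟨1, le_rfl, .move_cons h⟩

theorem Runs.seq {p q : StackProg K A σ} {v v₁ v₂ : σ} {S S₁ S₂ : K → List A} {B C : ℕ}
    (hp : Runs p v S B v₁ S₁) (hq : Runs q v₁ S₁ C v₂ S₂) :
    Runs (.seq p q) v S (B + C + 1) v₂ S₂ :=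
  let ⟨m, hm, hp⟩ := hp
  let ⟨n, hn, hq⟩ := hq
  ⟨n + m + 1, by omega, .seq hp hq⟩

theorem Runs.loop_done {a : K} {t : σ → Option A → Bool} {v : σ} {S : K → List A}
    (h : t v (S a).head? = false) (p : StackProg K A σ) : Runs (.loop a t p) v S 1 v S :=
  ⟨1, le_rfl, .loop_done h⟩

theorem Runs.loop_step {a : K} {t : σ → Option A → Bool} {p : StackProg K A σ} {v v₁ v₂ : σ}
    {S S₁ S₂ : K → List A} {B C : ℕ} (h : t v (S a).head? = true) (hp : Runs p v S B v₁ S₁)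
    (hq : Runs (.loop a t p) v₁ S₁ C v₂ S₂) : Runs (.loop a t p) v S (B + C + 1) v₂ S₂ :=
  let ⟨m, hm, hp⟩ := hp
  let ⟨n, hn, hq⟩ := hq
  ⟨n + m + 1, by omega, .loop_step h hp hq⟩

/-- Move the whole stack `a` onto all stacks in `bs`. -/
def moveAll (a : K) (bs : List K) : StackProg K A σ :=
  .loop a (fun _ s => s.isSome) (.move a bs fun v _ => v)

theorem pushOn_apply (x : A) {bs : List K} (hb : bs.Nodup) (S : K → List A) (k : K) :
    pushOn x bs S k = if k ∈ bs then x :: S k else S k := by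
  induction bs generalizing S with
  | nil => rfl
  | cons b bs ih =>
    have hb' := List.nodup_cons.1 hb
    have : pushOn x (b :: bs) S = pushOn x bs (update S b (x :: S b)) := rfl
    rw [this, ih hb'.2]
    by_cases hk : k = b
    · subst hk; simp [hb'.1]
    · simp [hk]

/-- Each symbol costs two steps, the loop test and the move; the last test costs one more. -/
theorem runs_moveAll {a : K} {bs : List K} (ha : a ∉ bs) (hb : bs.Nodup) (u : List A) (v : σ)
    (S : K → List A) (hu : S a = u) :
    Runs (moveAll a bs) v S (2 * u.length + 1) v
      (fun k => if k = a then [] else if k ∈ bs then u.reverse ++ S k else S k) := by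
  induction u generalizing S with
  | nil =>
    have : (fun k => if k = a then [] else if k ∈ bs then ([] : List A).reverse ++ S k else S k)
        = S := by
      funext k
      by_cases hk : k = a
      · subst hk; simp [hu]
      · simp [hk]
    rw [this]
    exact (Runs.loop_done (by simp [hu]) _).mono (by simp)
  | cons x u ih =>
    have h₂ := ih (pushOn x bs (update S a u)) (by simp [pushOn_apply _ hb, ha])
    refine (Runs.loop_step (by simp [hu]) (Runs.move_cons hu bs _ v) h₂).conv
      (by simp; omega) rfl ?_
    funext k
    by_cases hk : k = a
    · simp [hk]
    · by_cases hkb : k ∈ bs <;> simp [hk, hkb, pushOn_apply _ hb]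

end Runs

/-! ### The type of a word, and moving over fields -/

/-- Three stacks for each of two words: the reversed prefix, the suffix, and a scratch stack. -/
inductive Stk
  | l₁ | r₁ | t₁ | l₂ | r₂ | t₂
  deriving DecidableEq

instance : Fintype Stk where
  elems := {.l₁, .r₁, .t₁, .l₂, .r₂, .t₂}
  complete k := by cases k <;> simp

section TypeMachine

variable {A : Type} {m : ℕ}

/-- The contents of the six stacks. -/
def sixStacks (l₁ r₁ t₁ l₂ r₂ t₂ : List A) : Stk → List A
  | .l₁ => l₁
  | .r₁ => r₁
  | .t₁ => t₁
  | .l₂ => l₂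
  | .r₂ => r₂
  | .t₂ => t₂

/-- The part of the state used by a single comparison. -/
structure Scratch (A : Type) where
  last : Option A
  run : Bool
  res : Bool

/-- What a word reveals directly: its first symbol, and whether a separator occurs. -/
abbrev Desc (A : Type) : Type := Option A × Bool

/-- Which fields of two words agree. -/
abbrev Agreement (m : ℕ) : Type := Set (Fin m × Fin m)

/-- The part of the state that accumulates the type of a word. -/
structure Core (A : Type) (m : ℕ) where
  desc₁ : Desc A
  desc₂ : Desc A
  agree : Agreement m
  inner : Set (Desc A × Agreement m)
  outer : Set (Desc A × Set (Desc A × Agreement m))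

instance [Finite A] : Finite (Scratch A) :=
  Finite.of_injective (fun s => (s.last, s.run, s.res)) fun s t h => by
    cases s; cases t; simp_all

/-- The accumulated type is kept in the control state rather than on a stack, so finiteness is
essential here. -/
instance [Finite A] : Finite (Core A m) :=
  Finite.of_injective (fun s => (s.desc₁, s.desc₂, s.agree, s.inner, s.outer)) fun s t h => by
    cases s; cases t; simp_all

/-- The states of the machine that computes the type of a word. -/
abbrev TypeState (A : Type) (m : ℕ) : Type := Scratch A × Core A m

/-- Drop a word up to and including the first end mark. -/
def dropField (isEnd : A → Bool) : List A → List A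
  | [] => []
  | x :: u => if isEnd x then u else dropField isEnd u

/-- Whether two words agree up to and including the first end mark, which must exist. -/
def sameField [DecidableEq A] (isEnd : A → Bool) : List A → List A → Bool
  | x :: u, y :: v => if x = y then (if isEnd x then true else sameField isEnd u v) else false
  | _, _ => false

/-- The pairs of fields on which two words agree. -/
def agreement [DecidableEq A] (isEnd : A → Bool) (m : ℕ) (u v : List A) : Agreement m :=
  {p | sameField isEnd ((dropField isEnd)^[p.1] u) ((dropField isEnd)^[p.2] v) = true}

/-- The description of a word. -/
def desc [DecidableEq A] (sep : A) (u : List A) : Desc A := (u.head?, decide (sep ∈ u))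

/-- The nonempty suffixes of a word. -/
def suffixes (w : List A) : Set (List A) := {u | u ≠ [] ∧ u <:+ w}

/-- The type of a suffix `u` of `w`. -/
def suffixType [DecidableEq A] (isEnd : A → Bool) (sep : A) (m : ℕ) (w u : List A) : Desc A × Set (Desc A × Agreement m) :=
  (desc sep u, (fun v => (desc sep v, agreement isEnd m u v)) '' suffixes w)

/-- The type of a word: which pairs of suffixes agree on which fields. -/
def wordType [DecidableEq A] (isEnd : A → Bool) (sep : A) (m : ℕ) (w : List A) : Set (Desc A × Set (Desc A × Agreement m)) :=
  suffixType isEnd sep m w '' suffixes w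

/-- Move a field from `a` to `b`. -/
def skipField (isEnd : A → Bool) (a b : Stk) : StackProg Stk A (TypeState A m) :=
  .seq (.load fun v => ({v.1 with run := true}, v.2))
    (.loop a (fun v s => v.1.run && s.isSome)
      (.move a [b] fun v s => ({v.1 with run := !s.any isEnd}, v.2)))

/-- The removed prefix `c` need not be known: `c ++ dropField isEnd u = u` suffices to restore the
stack later. The final scratch state is left open because each use of it starts by resetting what it
reads. -/
theorem runs_skipField (isEnd : A → Bool) {a b : Stk} (hab : a ≠ b) (v : TypeState A m)
    (S : Stk → List A) (u : List A) (hu : S a = u) :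
    ∃ c s, c ++ dropField isEnd u = u ∧ Runs (skipField isEnd a b) v S (2 * u.length + 3) (s, v.2)
      (update (update S a (dropField isEnd u)) b (c.reverse ++ S b)) := by
  suffices h : ∀ (u : List A) (s : Scratch A) (S : Stk → List A), s.run = true → S a = u →
      ∃ c s', c ++ dropField isEnd u = u ∧ Runs (.loop a (fun v s => v.1.run && s.isSome)
        (.move a [b] fun v s => ({v.1 with run := !s.any isEnd}, v.2)))
        (s, v.2) S (2 * u.length + 1) (s', v.2)
        (update (update S a (dropField isEnd u)) b (c.reverse ++ S b)) by
    obtain ⟨c, s, hc, hs⟩ := h u {v.1 with run := true} S rfl hu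
    exact ⟨c, s, hc, ((Runs.load _ v S).seq hs).mono (by omega)⟩
  intro u
  induction u with
  | nil =>
    intro s S hs hu
    refine ⟨[], s, rfl, (Runs.loop_done (by simp [hu]) _).conv (by simp) rfl ?_⟩
    have h : update S a [] = S := by rw [← hu, update_eq_self]
    simp [dropField, h]
  | cons x u ih =>
    intro s S hs hu
    have h₁ := Runs.move_cons hu [b]
      (fun (v : TypeState A m) s => ({v.1 with run := !s.any isEnd}, v.2)) (s, v.2)
    have hba : b ≠ a := hab.symm
    by_cases hx : isEnd x
    · refine ⟨[x], {s with run := false}, by simp [dropField, hx], ?_⟩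
      have h₂ := Runs.loop_step (a := a) (t := fun v s => v.1.run && s.isSome) (by simp [hu, hs]) h₁
        (Runs.loop_done (by simp [hx]) _)
      refine h₂.conv (by simp) (by simp [hx]) ?_
      simp [dropField, hx, pushOn, hba]
    · obtain ⟨c, s', hc, h₂⟩ := ih {s with run := true} (pushOn x [b] (update S a u)) rfl
        (by simp [pushOn, hab])
      refine ⟨x :: c, s', by simp [dropField, hx, hc], ?_⟩
      have h₃ := Runs.loop_step (a := a) (t := fun v s => v.1.run && s.isSome) (by simp [hu, hs]) h₁
        (by simpa [hx] using h₂)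
      refine h₃.conv (by simp; omega) rfl ?_
      funext k
      by_cases hka : k = a <;> by_cases hkb : k = b <;> simp_all [dropField, pushOn, update]

/-- Move `j` fields from `a` to `b`. -/
def skipFields (isEnd : A → Bool) (a b : Stk) : ℕ → StackProg Stk A (TypeState A m)
  | 0 => .load id
  | j + 1 => .seq (skipField isEnd a b) (skipFields isEnd a b j)

theorem length_dropField_le (isEnd : A → Bool) (u : List A) : (dropField isEnd u).length ≤ u.length := by
  induction u with
  | nil => simp [dropField]
  | cons x u ih =>
    simp only [dropField]
    split
    · simp
    · simp; omega

theorem runs_skipFields (isEnd : A → Bool) {a b : Stk} (hab : a ≠ b) (j n : ℕ) (v : TypeState A m)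
    (S : Stk → List A) (u : List A) (hu : S a = u) (hn : u.length ≤ n) :
    ∃ c s, c ++ (dropField isEnd)^[j] u = u ∧ Runs (skipFields isEnd a b j) v S
      (j * (2 * n + 4) + 1) (s, v.2)
      (update (update S a ((dropField isEnd)^[j] u)) b (c.reverse ++ S b)) := by
  induction j generalizing v S u with
  | zero =>
    refine ⟨[], v.1, rfl, (Runs.load id v S).conv (by simp) rfl ?_⟩
    simp [← hu]
  | succ j ih =>
    obtain ⟨c, s, hc, h₁⟩ := runs_skipField isEnd hab v S u hu
    obtain ⟨d, s', hd, h₂⟩ := ih (s, v.2) (update (update S a (dropField isEnd u)) b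
      (c.reverse ++ S b)) (dropField isEnd u) (by simp [hab])
      ((length_dropField_le isEnd u).trans hn)
    refine ⟨c ++ d, s', by rw [iterate_succ_apply, List.append_assoc, hd, hc], ?_⟩
    refine (h₁.seq h₂).conv (by ring_nf; omega) rfl ?_
    funext k
    by_cases hka : k = a <;> by_cases hkb : k = b <;> simp_all [update]

end TypeMachine

/-! ### Comparing fields and looping over pairs of suffixes -/

section TypeProgram

variable {A : Type} [DecidableEq A] {m : ℕ}

/-- Compare the fields at the tops of the two suffixes. -/
def compareFields (isEnd : A → Bool) : StackProg Stk A (TypeState A m) :=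
  .seq (.load fun v => ({v.1 with run := true, res := false}, v.2))
    (.loop .r₁ (fun v s => v.1.run && s.isSome)
      (.seq (.move .r₁ [.t₁] fun v s => ({v.1 with last := s}, v.2))
        (.move .r₂ [.t₂] fun v s =>
          (if s = v.1.last then
            (if s.any isEnd then {v.1 with run := false, res := true} else v.1)
          else {v.1 with run := false}, v.2))))

theorem runs_compareFields (isEnd : A → Bool) (v : TypeState A m) (l₁ u t₁ l₂ w t₂ : List A) :
    ∃ c d u' w' s, c ++ u' = u ∧ d ++ w' = w ∧ s.res = sameField isEnd u w ∧
      Runs (compareFields isEnd) v (sixStacks l₁ u t₁ l₂ w t₂) (4 * u.length + 3) (s, v.2)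
        (sixStacks l₁ u' (c.reverse ++ t₁) l₂ w' (d.reverse ++ t₂)) := by
  suffices h : ∀ (u w t₁ t₂ : List A) (s : Scratch A), s.run = true → s.res = false →
      ∃ c d u' w' s', c ++ u' = u ∧ d ++ w' = w ∧ s'.res = sameField isEnd u w ∧
      Runs (.loop .r₁ (fun v s => v.1.run && s.isSome)
        (.seq (.move .r₁ [.t₁] fun v s => ({v.1 with last := s}, v.2))
          (.move .r₂ [.t₂] fun v s =>
            (if s = v.1.last then
              (if s.any isEnd then {v.1 with run := false, res := true} else v.1)
            else {v.1 with run := false}, v.2)))) (s, v.2) (sixStacks l₁ u t₁ l₂ w t₂)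
        (4 * u.length + 1) (s', v.2)
        (sixStacks l₁ u' (c.reverse ++ t₁) l₂ w' (d.reverse ++ t₂)) by
    obtain ⟨c, d, u', w', s, hc, hd, hs, h⟩ := h u w t₁ t₂ {v.1 with run := true, res := false} rfl rfl
    exact ⟨c, d, u', w', s, hc, hd, hs, ((Runs.load _ v _).seq h).mono (by omega)⟩
  intro u
  induction u with
  | nil =>
    intro w t₁ t₂ s hs hr
    exact ⟨[], [], [], w, s, rfl, rfl, by simp [sameField, hr],
      (Runs.loop_done (by simp [sixStacks]) _).mono (by simp)⟩
  | cons x u ih =>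
    intro w t₁ t₂ s hs hr
    have h₁ := Runs.move_cons (S := sixStacks l₁ (x :: u) t₁ l₂ w t₂) (a := .r₁) rfl [.t₁]
      (fun (v : TypeState A m) s => ({v.1 with last := s}, v.2)) (s, v.2)
    have e₁ : pushOn x [Stk.t₁] (update (sixStacks l₁ (x :: u) t₁ l₂ w t₂) .r₁ u) =
        sixStacks l₁ u (x :: t₁) l₂ w t₂ := by
      funext k; cases k <;> simp [pushOn, sixStacks, update]
    rw [e₁] at h₁
    cases w with
    | nil =>
      -- Popping the exhausted second word yields `none`, which differs from the recorded `some x`;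
      -- the comparison stops with a negative result.
      refine ⟨[x], [], u, [], {s with run := false, last := some x}, rfl, rfl,
        by simp [sameField, hr], ?_⟩
      refine (Runs.loop_step (by simp [sixStacks, hs])
        (h₁.seq ⟨1, le_rfl, .move_nil (by simp [sixStacks])⟩)
        (Runs.loop_done (by simp) _)).conv (by simp +arith) (by simp) rfl
    | cons y w =>
      have h₂ := h₁.seq (Runs.move_cons (S := sixStacks l₁ u (x :: t₁) l₂ (y :: w) t₂) (a := .r₂)
        rfl [.t₂] (fun (v : TypeState A m) s =>
            (if s = v.1.last then
              (if s.any isEnd then {v.1 with run := false, res := true} else v.1)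
            else {v.1 with run := false}, v.2)) _)
      have e₂ : pushOn y [Stk.t₂] (update (sixStacks l₁ u (x :: t₁) l₂ (y :: w) t₂) .r₂ w) =
          sixStacks l₁ u (x :: t₁) l₂ w (y :: t₂) := by
        funext k; cases k <;> simp [pushOn, sixStacks, update]
      rw [e₂] at h₂
      by_cases hxy : x = y
      · subst hxy
        by_cases hx : isEnd x
        · refine ⟨[x], [x], u, w, {s with run := false, res := true, last := some x}, rfl, rfl,
            by simp [sameField, hx], ?_⟩
          exact (Runs.loop_step (by simp [sixStacks, hs]) h₂
            (Runs.loop_done (by simp [hx]) _)).conv (by simp +arith) (by simp [hx]) rfl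
        · obtain ⟨c, d, u', w', s', hc, hd, hs', h₃⟩ := ih w (x :: t₁) (x :: t₂)
            {s with last := some x} hs hr
          refine ⟨x :: c, x :: d, u', w', s', by simp [hc], by simp [hd], by simp [sameField, hx, hs'], ?_⟩
          exact (Runs.loop_step (by simp [sixStacks, hs]) h₂ (by simpa [hx] using h₃)).conv
            (by simp; omega) rfl (by simp)
      · refine ⟨[x], [y], u, w, {s with run := false, last := some x}, rfl, rfl,
          by simp [sameField, hxy, hr], ?_⟩
        have hyx : y ≠ x := Ne.symm hxy
        exact (Runs.loop_step (by simp [sixStacks, hs]) h₂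
          (Runs.loop_done (by simp [hyx]) _)).conv (by simp +arith) (by simp [hyx]) rfl

/-- Test whether the field `p.1` of the first suffix agrees with the field `p.2` of the second one,
and record the result. -/
def testFields (isEnd : A → Bool) (p : Fin m × Fin m) : StackProg Stk A (TypeState A m) :=
  .seq (skipFields isEnd .r₁ .t₁ p.1) <| .seq (skipFields isEnd .r₂ .t₂ p.2) <|
  .seq (compareFields isEnd) <| .seq (moveAll .t₁ [.r₁]) <| .seq (moveAll .t₂ [.r₂]) <|
  .load fun v => (v.1, {v.2 with agree := v.2.agree ∪ {q | q = p ∧ v.1.res = true}})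

/-- Whatever was skipped or compared lies reversed on the scratch stacks, so emptying these back
restores both suffixes and the next test starts from the same configuration. -/
theorem runs_testFields (isEnd : A → Bool) (p : Fin m × Fin m) (v : TypeState A m)
    (l₁ u l₂ w : List A) (n : ℕ) (hu : u.length ≤ n) (hw : w.length ≤ n) :
    ∃ s, Runs (testFields isEnd p) v (sixStacks l₁ u [] l₂ w [])
      (2 * (m * (2 * n + 4)) + 8 * n + 13)
      (s, {v.2 with agree := v.2.agree ∪ {q | q = p ∧ q ∈ agreement isEnd m u w}})
      (sixStacks l₁ u [] l₂ w []) := by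
  obtain ⟨c, s₁, hc, h₁⟩ := runs_skipFields isEnd (a := .r₁) (b := .t₁) (by decide) p.1 n v
    (sixStacks l₁ u [] l₂ w []) u rfl hu
  have e₁ : update (update (sixStacks l₁ u [] l₂ w []) .r₁ ((dropField isEnd)^[p.1] u)) .t₁
      (c.reverse ++ []) = sixStacks l₁ ((dropField isEnd)^[p.1] u) c.reverse l₂ w [] := by
    funext k; cases k <;> simp [sixStacks, update]
  change Runs _ _ _ _ _ (update (update (sixStacks l₁ u [] l₂ w []) .r₁
    ((dropField isEnd)^[p.1] u)) .t₁ (c.reverse ++ [])) at h₁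
  rw [e₁] at h₁
  set u₁ := (dropField isEnd)^[p.1] u with hu₁
  obtain ⟨d, s₂, hd, h₂⟩ := runs_skipFields isEnd (a := .r₂) (b := .t₂) (by decide) p.2 n (s₁, v.2)
    (sixStacks l₁ u₁ c.reverse l₂ w []) w rfl hw
  have e₂ : update (update (sixStacks l₁ u₁ c.reverse l₂ w []) .r₂ ((dropField isEnd)^[p.2] w)) .t₂
      (d.reverse ++ []) =
        sixStacks l₁ u₁ c.reverse l₂ ((dropField isEnd)^[p.2] w) d.reverse := by
    funext k; cases k <;> simp [sixStacks, update]
  change Runs _ _ _ _ _ (update (update (sixStacks l₁ u₁ c.reverse l₂ w []) .r₂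
    ((dropField isEnd)^[p.2] w)) .t₂ (d.reverse ++ [])) at h₂
  rw [e₂] at h₂
  set w₁ := (dropField isEnd)^[p.2] w with hw₁
  obtain ⟨c', d', u₂, w₂, s₃, hc', hd', hs₃, h₃⟩ := runs_compareFields isEnd (s₂, v.2) l₁ u₁
    c.reverse l₂ w₁ d.reverse
  have h₄ := runs_moveAll (a := Stk.t₁) (bs := [.r₁]) (by simp) (by simp) _ (s₃, v.2)
    (sixStacks l₁ u₂ (c'.reverse ++ c.reverse) l₂ w₂ (d'.reverse ++ d.reverse)) rfl
  have e₄ : (fun k => if k = Stk.t₁ then [] else if k ∈ [Stk.r₁] then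
      (sixStacks l₁ u₂ (c'.reverse ++ c.reverse) l₂ w₂ (d'.reverse ++ d.reverse) Stk.t₁).reverse ++
        sixStacks l₁ u₂ (c'.reverse ++ c.reverse) l₂ w₂ (d'.reverse ++ d.reverse) k else
        sixStacks l₁ u₂ (c'.reverse ++ c.reverse) l₂ w₂ (d'.reverse ++ d.reverse) k) =
      sixStacks l₁ u [] l₂ w₂ (d'.reverse ++ d.reverse) := by
    funext k; cases k <;> simp [sixStacks, ← hc, ← hc']
  rw [e₄] at h₄
  have h₅ := runs_moveAll (a := Stk.t₂) (bs := [.r₂]) (by simp) (by simp) _ (s₃, v.2)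
    (sixStacks l₁ u [] l₂ w₂ (d'.reverse ++ d.reverse)) rfl
  have e₅ : (fun k => if k = Stk.t₂ then [] else if k ∈ [Stk.r₂] then
      (sixStacks l₁ u [] l₂ w₂ (d'.reverse ++ d.reverse) Stk.t₂).reverse ++
        sixStacks l₁ u [] l₂ w₂ (d'.reverse ++ d.reverse) k else
        sixStacks l₁ u [] l₂ w₂ (d'.reverse ++ d.reverse) k) =
      sixStacks l₁ u [] l₂ w [] := by
    funext k; cases k <;> simp [sixStacks, ← hd, ← hd']
  rw [e₅] at h₅
  refine ⟨s₃, (h₁.seq <| h₂.seq <| h₃.seq <| h₄.seq <| h₅.seq <| Runs.load _ _ _).conv ?_ ?_ rfl⟩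
  · have l₁ : u₁.length + c.length ≤ n := by
      rw [← hc, List.length_append] at hu; omega
    have l₂ : w₁.length + d.length ≤ n := by
      rw [← hd, List.length_append] at hw; omega
    have l₃ : c'.length ≤ u₁.length := by rw [← hc']; simp
    have l₄ : d'.length ≤ w₁.length := by rw [← hd']; simp
    have l₅ : (p.1 : ℕ) * (2 * n + 4) ≤ m * (2 * n + 4) := Nat.mul_le_mul_right _ p.1.2.le
    have l₆ : (p.2 : ℕ) * (2 * n + 4) ≤ m * (2 * n + 4) := Nat.mul_le_mul_right _ p.2.2.le
    simp only [sixStacks, List.length_append, List.length_reverse]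
    omega
  · simp only [hs₃, Prod.mk.injEq, true_and]
    congr 2
    ext q
    simp only [Set.mem_ofPred_eq, agreement]
    constructor <;> rintro ⟨rfl, h⟩ <;> exact ⟨rfl, h⟩

/-- Test all pairs of fields in a list. -/
def testAll (isEnd : A → Bool) : List (Fin m × Fin m) → StackProg Stk A (TypeState A m)
  | [] => .load id
  | p :: L => .seq (testFields isEnd p) (testAll isEnd L)

theorem runs_testAll (isEnd : A → Bool) (L : List (Fin m × Fin m)) (v : TypeState A m)
    (l₁ u l₂ w : List A) (n : ℕ) (hu : u.length ≤ n) (hw : w.length ≤ n) :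
    ∃ s, Runs (testAll isEnd L) v (sixStacks l₁ u [] l₂ w [])
      (L.length * (2 * (m * (2 * n + 4)) + 8 * n + 14) + 1)
      (s, {v.2 with agree := v.2.agree ∪ {q | q ∈ L ∧ q ∈ agreement isEnd m u w}})
      (sixStacks l₁ u [] l₂ w []) := by
  induction L generalizing v with
  | nil => exact ⟨v.1, (Runs.load id v _).conv (by simp) (by simp) rfl⟩
  | cons p L ih =>
    obtain ⟨s, h₁⟩ := runs_testFields isEnd p v l₁ u l₂ w n hu hw
    obtain ⟨s', h₂⟩ := ih (s, _)
    refine ⟨s', (h₁.seq h₂).conv ?_ ?_ rfl⟩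
    · rw [List.length_cons, Nat.add_one_mul (L.length)]
      omega
    · simp only [Prod.mk.injEq, true_and]
      congr 1
      ext q
      simp only [Set.mem_union, Set.mem_ofPred_eq, List.mem_cons]
      tauto

/-- The words that are on top when the stack `l` is moved symbol by symbol onto `u`. -/
def visited : List A → List A → Set (List A)
  | [], _ => ∅
  | x :: l, u => insert (x :: u) (visited l (x :: u))

/-- Every move lengthens the visited word by one symbol, and a suffix of a given word is determined
by its length. -/
theorem mem_visited {A : Type} {l u w : List A} :
    w ∈ visited l u ↔ w <:+ l.reverse ++ u ∧ u.length < w.length := by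
  induction l generalizing u with
  | nil =>
    simp only [visited, Set.mem_empty_iff_false, List.reverse_nil, List.nil_append, false_iff]
    exact fun h => absurd h.1.length_le (by omega)
  | cons x l ih =>
    simp only [visited, Set.mem_insert_iff, ih, List.reverse_cons, List.append_assoc,
      List.cons_append, List.nil_append, List.length_cons]
    constructor
    · rintro (rfl | h)
      · exact ⟨List.suffix_append _ _, by simp⟩
      · exact ⟨h.1, by omega⟩
    · rintro ⟨h, hl⟩
      rcases (Nat.succ_le_of_lt hl).eq_or_lt with h' | h'
      · left
        exact (List.suffix_of_suffix_length_le h (List.suffix_append l.reverse (x :: u))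
          (by simp; omega)).eq_of_length (by simp; omega)
      · exact Or.inr ⟨h, h'⟩

theorem visited_reverse {A : Type} (w : List A) : visited w.reverse [] = suffixes w := by
  ext u
  simp only [mem_visited, suffixes, List.reverse_reverse, Set.mem_ofPred_eq, List.append_nil,
    List.length_nil, List.length_pos_iff]
  tauto

/-- Proceed to the next second suffix. -/
def nextSecond (sep : A) (v : TypeState A m) (s : Option A) : TypeState A m :=
  (v.1, {v.2 with desc₂ := (s, decide (s = some sep) || v.2.desc₂.2), agree := ∅})

/-- Record how the two suffixes agree. -/
def recordPair (v : TypeState A m) : TypeState A m :=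
  (v.1, {v.2 with inner := insert (v.2.desc₂, v.2.agree) v.2.inner})

/-- Proceed to the next first suffix. -/
def nextFirst (sep : A) (v : TypeState A m) (s : Option A) : TypeState A m :=
  (v.1, {v.2 with
    desc₁ := (s, decide (s = some sep) || v.2.desc₁.2), desc₂ := (none, false), inner := ∅})

/-- Record the type of the first suffix. -/
def recordType (v : TypeState A m) : TypeState A m :=
  (v.1, {v.2 with outer := insert (v.2.desc₁, v.2.inner) v.2.outer})

/-- Run through all second suffixes and collect how they agree with the first one. -/
def innerLoop (isEnd : A → Bool) (sep : A) (L : List (Fin m × Fin m)) : StackProg Stk A (TypeState A m) :=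
  .loop .l₂ (fun _ s => s.isSome) <|
    .seq (.move .l₂ [.r₂] (nextSecond sep)) <| .seq (testAll isEnd L) <| .load recordPair

/-- A time bound for one round of the inner loop. -/
def innerRound (k m n : ℕ) : ℕ := k * (2 * (m * (2 * n + 4)) + 8 * n + 14) + 6

/-- The invariant `hv` says that the separator flag is right for the current second suffix `w`.
Descriptions are thus updated from one symbol at a time, without rescanning. -/
theorem runs_innerLoop (isEnd : A → Bool) (sep : A) {L : List (Fin m × Fin m)} (hL : ∀ q, q ∈ L) (n : ℕ)
    (l₁ u : List A) (hu : u.length ≤ n) (l : List A) (v : TypeState A m) (w : List A)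
    (hw : l.length + w.length ≤ n) (hv : v.2.desc₂.2 = decide (sep ∈ w)) :
    ∃ v', Runs (innerLoop isEnd sep L) v (sixStacks l₁ u [] l w [])
      (l.length * innerRound L.length m n + 1) v' (sixStacks l₁ u [] [] (l.reverse ++ w) []) ∧
      v'.2.desc₁ = v.2.desc₁ ∧ v'.2.outer = v.2.outer ∧
      v'.2.inner = v.2.inner ∪ (fun w => (desc sep w, agreement isEnd m u w)) '' visited l w := by
  induction l generalizing v w with
  | nil =>
    exact ⟨v, (Runs.loop_done (by simp [sixStacks]) _).conv (by simp) rfl (by simp), rfl, rfl,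
      by simp [visited]⟩
  | cons x l ih =>
    have h₁ := Runs.move_cons (S := sixStacks l₁ u [] (x :: l) w []) (a := .l₂) rfl [.r₂]
      (nextSecond sep) v
    have e₁ : pushOn x [Stk.r₂] (update (sixStacks l₁ u [] (x :: l) w []) .l₂ l) =
        sixStacks l₁ u [] l (x :: w) [] := by
      funext k; cases k <;> simp [pushOn, sixStacks, update]
    rw [e₁] at h₁
    rw [List.length_cons] at hw
    obtain ⟨s, h₂⟩ := runs_testAll isEnd L _ l₁ u l (x :: w) n hu (by rw [List.length_cons]; omega)
    -- Of the state after one round, only these four components matter for the induction.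
    obtain ⟨v₃, h₃, hd₁, ho₁, hd₂, hi₁⟩ : ∃ v₃, Runs (.seq (.move .l₂ [.r₂] (nextSecond sep)) <|
        .seq (testAll isEnd L) <| .load recordPair) v (sixStacks l₁ u [] (x :: l) w [])
        (L.length * (2 * (m * (2 * n + 4)) + 8 * n + 14) + 5) v₃ (sixStacks l₁ u [] l (x :: w) []) ∧
        v₃.2.desc₁ = v.2.desc₁ ∧ v₃.2.outer = v.2.outer ∧ v₃.2.desc₂.2 = decide (sep ∈ x :: w) ∧
        v₃.2.inner = insert (desc sep (x :: w), agreement isEnd m u (x :: w)) v.2.inner :=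
      ⟨_, (h₁.seq (h₂.seq (Runs.load recordPair _ _))).mono (by omega), rfl, rfl,
        by simp [recordPair, nextSecond, hv, eq_comm],
        by simp [recordPair, nextSecond, desc, hv, hL, eq_comm]⟩
    obtain ⟨v', h₄, hd, ho, hi⟩ := ih v₃ (x :: w) (by rw [List.length_cons]; omega) hd₂
    refine ⟨v', (Runs.loop_step (by simp [sixStacks]) h₃ h₄).conv ?_ rfl (by simp),
      hd.trans hd₁, ho.trans ho₁, ?_⟩
    · rw [List.length_cons, Nat.add_one_mul l.length]
      simp only [innerRound]
      omega
    · rw [hi, hi₁, visited, Set.image_insert_eq, Set.union_insert, Set.insert_union]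

/-- Run through all first suffixes and collect their types. -/
def outerLoop (isEnd : A → Bool) (sep : A) (L : List (Fin m × Fin m)) : StackProg Stk A (TypeState A m) :=
  .loop .l₁ (fun _ s => s.isSome) <|
    .seq (.move .l₁ [.r₁] (nextFirst sep)) <| .seq (innerLoop isEnd sep L) <|
    .seq (moveAll .r₂ [.l₂]) <| .load recordType

/-- A time bound for one round of the outer loop. -/
def outerRound (k m n : ℕ) : ℕ := n * innerRound k m n + 2 * n + 8

/-- After each inner loop the second word stands entirely on `r₂`; moving it back to `l₂` rewinds it
for the next first suffix. -/
theorem runs_outerLoop (isEnd : A → Bool) (sep : A) {L : List (Fin m × Fin m)} (hL : ∀ q, q ∈ L)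
    (w l : List A) (v : TypeState A m) (u : List A)
    (hu : l.length + u.length ≤ w.length) (hv : v.2.desc₁.2 = decide (sep ∈ u)) :
    ∃ v', Runs (outerLoop isEnd sep L) v (sixStacks l u [] w.reverse [] [])
      (l.length * outerRound L.length m w.length + 1) v'
      (sixStacks [] (l.reverse ++ u) [] w.reverse [] []) ∧
      v'.2.outer = v.2.outer ∪ suffixType isEnd sep m w '' visited l u := by
  induction l generalizing v u with
  | nil =>
    exact ⟨v, (Runs.loop_done (by simp [sixStacks]) _).conv (by simp) rfl (by simp),
      by simp [visited]⟩
  | cons x l ih =>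
    have h₁ := Runs.move_cons (S := sixStacks (x :: l) u [] w.reverse [] []) (a := .l₁) rfl [.r₁]
      (nextFirst sep) v
    have e₁ : pushOn x [Stk.r₁] (update (sixStacks (x :: l) u [] w.reverse [] []) .l₁ l) =
        sixStacks l (x :: u) [] w.reverse [] [] := by
      funext k; cases k <;> simp [pushOn, sixStacks, update]
    rw [e₁] at h₁
    rw [List.length_cons] at hu
    obtain ⟨v₂, h₂, hd, ho, hi⟩ := runs_innerLoop isEnd sep hL w.length l (x :: u)
      (by rw [List.length_cons]; omega) w.reverse
      (nextFirst sep v (some x)) [] (by simp) (by simp [nextFirst])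
    have h₃ := runs_moveAll (a := Stk.r₂) (bs := [.l₂]) (by simp) (by simp) _ v₂
      (sixStacks l (x :: u) [] [] (w.reverse.reverse ++ []) []) rfl
    have e₃ : (fun k => if k = Stk.r₂ then [] else if k ∈ [Stk.l₂] then
        (sixStacks l (x :: u) [] [] (w.reverse.reverse ++ []) [] Stk.r₂).reverse ++
          sixStacks l (x :: u) [] [] (w.reverse.reverse ++ []) [] k else
          sixStacks l (x :: u) [] [] (w.reverse.reverse ++ []) [] k) =
        sixStacks l (x :: u) [] w.reverse [] [] := by
      funext k; cases k <;> simp [sixStacks]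
    rw [e₃] at h₃
    obtain ⟨v₄, h₄, hd₄, ho₄⟩ : ∃ v₄, Runs (.seq (.move .l₁ [.r₁] (nextFirst sep)) <|
        .seq (innerLoop isEnd sep L) <| .seq (moveAll .r₂ [.l₂]) <| .load recordType) v
        -- One step of the round is reserved for the loop test.
        (sixStacks (x :: l) u [] w.reverse [] []) (outerRound L.length m w.length - 1) v₄
        (sixStacks l (x :: u) [] w.reverse [] []) ∧ v₄.2.desc₁.2 = decide (sep ∈ x :: u) ∧
        v₄.2.outer = insert (suffixType isEnd sep m w (x :: u)) v.2.outer := by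
      refine ⟨_, (h₁.seq (h₂.seq (h₃.seq (Runs.load recordType _ _)))).mono ?_, ?_, ?_⟩
      · simp only [outerRound, sixStacks, List.length_append, List.length_reverse, List.length_nil]
        omega
      · simp [recordType, nextFirst, hd, hv, eq_comm]
      · simp [recordType, nextFirst, hd, hi, ho, hv, suffixType, desc, visited_reverse, eq_comm]
    obtain ⟨v', h₅, ho'⟩ := ih v₄ (x :: u) (by rw [List.length_cons]; omega) hd₄
    refine ⟨v', (Runs.loop_step (by simp [sixStacks]) h₄ h₅).conv ?_ rfl (by simp), ?_⟩
    · have : 1 ≤ outerRound L.length m w.length := by simp [outerRound]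
      rw [List.length_cons, Nat.add_one_mul l.length]
      omega
    · rw [ho', ho₄, visited, Set.image_insert_eq, Set.union_insert, Set.insert_union]

/-- The program that computes the type of a word. -/
def typeProgram (isEnd : A → Bool) (sep : A) (L : List (Fin m × Fin m)) : StackProg Stk A (TypeState A m) :=
  .seq (moveAll .r₁ [.l₁, .l₂]) <| .seq (outerLoop isEnd sep L) <|
  .seq (moveAll .r₁ []) (moveAll .l₂ [])

/-- The initial state of the program that computes the type of a word. -/
def initialState (A : Type) (m : ℕ) : TypeState A m :=
  (⟨none, false, false⟩, ⟨(none, false), (none, false), ∅, ∅, ∅⟩)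

theorem runs_typeProgram (isEnd : A → Bool) (sep : A) {L : List (Fin m × Fin m)} (hL : ∀ q, q ∈ L)
    (w : List A) :
    ∃ v, Runs (typeProgram isEnd sep L) (initialState A m) (update (fun _ => []) .r₁ w)
      (w.length * outerRound L.length m w.length + 6 * w.length + 7) v (fun _ => []) ∧
      v.2.outer = wordType isEnd sep m w := by
  have h₁ := runs_moveAll (a := Stk.r₁) (bs := [.l₁, .l₂]) (by simp) (by simp) w
    (initialState A m) (update (fun _ => []) .r₁ w) (by simp)
  have e₁ : (fun k => if k = Stk.r₁ then [] else if k ∈ [Stk.l₁, .l₂] then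
      w.reverse ++ update (fun _ => []) Stk.r₁ w k else update (fun _ => []) Stk.r₁ w k) =
      sixStacks w.reverse [] [] w.reverse [] [] := by
    funext k; cases k <;> simp [sixStacks]
  rw [e₁] at h₁
  obtain ⟨v, h₂, ho⟩ := runs_outerLoop isEnd sep hL w w.reverse (initialState A m) []
    (by simp) (by simp [initialState])
  have h₃ := runs_moveAll (a := Stk.r₁) (bs := []) (by simp) (by simp) _ v
    (sixStacks [] (w.reverse.reverse ++ []) [] w.reverse [] []) rfl
  have h₄ := runs_moveAll (a := Stk.l₂) (bs := []) (by simp) (by simp) w.reverse v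
    (fun k => if k = Stk.r₁ then [] else if k ∈ [] then
      (sixStacks [] (w.reverse.reverse ++ []) [] w.reverse [] [] Stk.r₁).reverse ++
        sixStacks [] (w.reverse.reverse ++ []) [] w.reverse [] [] k else
      sixStacks [] (w.reverse.reverse ++ []) [] w.reverse [] [] k) rfl
  refine ⟨v, (h₁.seq (h₂.seq (h₃.seq h₄))).conv ?_ rfl ?_, ?_⟩
  · simp only [sixStacks, List.length_append, List.length_reverse, List.length_nil]
    omega
  · funext k; cases k <;> simp [sixStacks]
  · rw [ho, visited_reverse, wordType, initialState, Set.empty_union]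

end TypeProgram

open Classical in
/-- A problem is decidable in polynomial time if membership depends only on the type of the encoded
input. -/
theorem decidableInPolyTime_of_wordType {A α : Type} [Fintype A] [DecidableEq A] (enc : α → List A) (X : Set α)
    (isEnd : A → Bool) (sep : A) (m : ℕ) (G : Set (Desc A × Set (Desc A × Agreement m)) → Prop)
    (hG : ∀ a, a ∈ X ↔ G (wordType isEnd sep m (enc a))) : DecidableInPolyTime enc X := by
  have : Inhabited A := ⟨sep⟩
  have : Fintype (TypeState A m) := Fintype.ofFinite _
  let L : List (Fin m × Fin m) := Finset.univ.toList
  have hL : ∀ q, q ∈ L := by simp [L]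
  let n : Polynomial ℕ := .X
  refine decidableInPolyTime enc X (typeProgram isEnd sep L) .r₁ (initialState A m)
    (fun v => decide (G v.2.outer))
    -- The bound of `runs_typeProgram`, with `outerRound` and `innerRound` unfolded: a cubic
    -- polynomial, as `m` and the length of `L` are fixed.
    (n * (n * (L.length * (2 * (m * (2 * n + 4)) + 8 * n + 14) + 6) + 2 * n + 8) + 6 * n + 7)
    fun a => ?_
  obtain ⟨v, ⟨k, hk, h⟩, ho⟩ := runs_typeProgram isEnd sep hL (enc a)
  refine ⟨k, hk.trans_eq ?_, v, h, by rw [decide_eq_true_iff, hG, ho]⟩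
  simp [n, outerRound, innerRound]

end StackProg

variable {S : Schema} {D N : Type}

/-! ## Repairs in terms of single insertions -/

theorem DBInstance.consistent_iff {F : Set (FD S)} {I : Set (IND S)} {r : DBInstance S D N} :
    r.Consistent (Constraint.fd '' F ∪ Constraint.ind '' I) ↔
      (∀ φ ∈ F, φ.Holds r) ∧ ∀ φ ∈ I, φ.Holds r := by
  simp only [DBInstance.Consistent, Set.mem_union, Set.mem_image]
  constructor
  · intro h
    exact ⟨fun φ hφ => h (.fd φ) (Or.inl ⟨φ, hφ, rfl⟩), fun φ hφ => h (.ind φ) (Or.inr ⟨φ, hφ, rfl⟩)⟩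
  · rintro ⟨hF, hI⟩ _ (⟨φ, hφ, rfl⟩ | ⟨φ, hφ, rfl⟩)
    · exact hF φ hφ
    · exact hI φ hφ

theorem FD.Holds.anti {φ : FD S} {r r' : DBInstance S D N} (h : φ.Holds r')
    (hr : r.facts ⊆ r'.facts) : φ.Holds r :=
  fun s hs t ht => h s (@hr ⟨φ.P, s⟩ hs) t (@hr ⟨φ.P, t⟩ ht)

/-- Acyclicity makes the transitive closure of the edges a strict order; on finitely many relation
names it is well-founded, so `X` has a minimal element. -/
theorem AcyclicINDs.exists_sink {I : Set (IND S)} (hI : AcyclicINDs I) {X : Set S.Rel}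
    (hX : X.Nonempty) : ∃ Q ∈ X, ∀ P, INDEdge I Q P → P ∉ X := by
  let R : S.Rel → S.Rel → Prop := fun P Q => Relation.TransGen (INDEdge I) Q P
  have : IsTrans S.Rel R := ⟨fun _ _ _ h h' => Relation.TransGen.trans h' h⟩
  have : Std.Irrefl R := ⟨hI⟩
  obtain ⟨Q, hQ, h⟩ := (Finite.wellFounded_of_trans_of_irrefl R).has_min X hX
  exact ⟨Q, hQ, fun P hP hPX => h P hPX (.single hP)⟩

/-- Minimality against all consistent subinstances reduces to single insertions. This is the only
place where cycles of length greater than one have to be excluded. -/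
theorem isRepair_iff {F : Set (FD S)} {I : Set (IND S)} (hI : AcyclicINDs I)
    (l l' : List (DBFact S D N)) :
    IsRepair (Constraint.fd '' F ∪ Constraint.ind '' I) (DBInstance.ofList l)
        (DBInstance.ofList l') ↔
      (∀ f ∈ l', f ∈ l) ∧
      (DBInstance.ofList l').Consistent (Constraint.fd '' F ∪ Constraint.ind '' I) ∧
      ∀ f ∈ l, f ∈ l' ∨
        ¬ (DBInstance.ofList (f :: l')).Consistent (Constraint.fd '' F ∪ Constraint.ind '' I) := by
  rw [IsRepair, and_assoc]
  refine and_congr_right fun hsub => (and_congr_right fun hc => ⟨fun h f hf => ?_, fun h r hr hrc hcl => ?_⟩)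
  · rw [or_iff_not_imp_left]
    intro hf' hcf
    -- If adding `f` were consistent, minimality against the enlarged instance would force `f` to be
    -- missing from it.
    refine (h (DBInstance.ofList (f :: l')) ?_ hcf (fun g hg => ⟨hg.1, fun hg' => hg.2 ?_⟩)
      (show f ∈ deltaMinus _ _ from ⟨hf, hf'⟩)).2 (List.mem_cons_self ..)
    · rintro g hg
      rcases List.mem_cons.1 hg with rfl | hg
      · exact hf
      · exact hsub hg
    · exact List.mem_cons_of_mem _ hg'
  · have hsub' : (DBInstance.ofList l').facts ⊆ r.facts := fun g hg => by
      by_contra hgr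
      exact (hcl ⟨hsub hg, hgr⟩).2 hg
    intro f hf
    refine ⟨hf.1, fun hfr => ?_⟩
    -- Among the relations where `r` has a fact missing from `l'`, take a sink `Q`, and add such a
    -- fact `t` over `Q`.
    obtain ⟨Q, ⟨t, htr, htl⟩, hQ⟩ := hI.exists_sink
      (X := {P | ∃ t : DBTuple S D N P, (⟨P, t⟩ : DBFact S D N) ∈ r.facts ∧
        (⟨P, t⟩ : DBFact S D N) ∉ l'}) ⟨f.1, f.2, hfr, hf.2⟩
    rcases h ⟨Q, t⟩ (hr htr) with h | h
    · exact htl h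
    refine h (DBInstance.consistent_iff.2 ⟨fun φ hφ => ?_, fun φ hφ s hs => ?_⟩)
    · refine ((DBInstance.consistent_iff.1 hrc).1 φ hφ).anti fun g hg => ?_
      rcases List.mem_cons.1 hg with hgt | hg
      · exact (show g = ⟨Q, t⟩ from hgt) ▸ htr
      · exact hsub' hg
    · rcases List.mem_cons.1 hs with hst | hs
      · obtain ⟨t', ht', h'⟩ := (DBInstance.consistent_iff.1 hrc).2 φ hφ s
          (show (⟨φ.Q, s⟩ : DBFact S D N) ∈ r.facts from hst ▸ htr)
        refine ⟨t', List.mem_cons_of_mem _ ?_, h'⟩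
        -- A witness outside `l'` would put its relation among those just considered, although `Q`
        -- has an edge to it.
        by_contra hcon
        exact hQ φ.P ⟨φ, hφ, congrArg Sigma.fst hst, rfl⟩ ⟨t', ht', hcon⟩
      · obtain ⟨t', ht', h'⟩ := (DBInstance.consistent_iff.1 hc).2 φ hφ s hs
        exact ⟨t', List.mem_cons_of_mem _ ht', h'⟩

/-! ## Constraints in terms of agreements between facts -/

/-- The entry number `i` of `f` is the entry number `j` of `g`. -/
def AgreeAt (f g : DBFact S D N) (i j : ℕ) : Prop :=
  ∃ (hi : i < S.arity f.1) (hj : j < S.arity g.1), f.2.1 ⟨i, hi⟩ = g.2.1 ⟨j, hj⟩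

/-- Two facts over `P` and `Q` with agreements `E` are equal. -/
def SameFact (P Q : S.Rel) (E : ℕ → ℕ → Prop) : Prop :=
  P = Q ∧ ∀ i < S.arity P, E i i

/-- Two facts over `P` and `Q` with agreements `E` do not violate `φ`. -/
def FD.Admits (φ : FD S) (P Q : S.Rel) (E : ℕ → ℕ → Prop) : Prop :=
  P = φ.P → Q = φ.P → (∀ i ∈ φ.X, E i i) → ∀ i ∈ φ.Y, E i i

/-- A fact over `P` with agreements `E` is a witness for a fact over the left-hand side of `φ`. -/
def IND.Witnesses (φ : IND S) (P : S.Rel) (E : ℕ → ℕ → Prop) : Prop :=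
  P = φ.P ∧ ∀ k, E (φ.Y k) (φ.X k)

theorem sameFact_iff (f g : DBFact S D N) : SameFact f.1 g.1 (AgreeAt f g) ↔ f = g := by
  obtain ⟨P, s⟩ := f
  obtain ⟨Q, t⟩ := g
  constructor
  · rintro ⟨h, h'⟩
    obtain rfl : P = Q := h
    congr 1
    exact Subtype.ext (funext fun i => (h' i i.2).2.2)
  · rintro ⟨⟩
    exact ⟨rfl, fun i hi => ⟨hi, hi, rfl⟩⟩

theorem FD.holds_ofList_iff (φ : FD S) (l : List (DBFact S D N)) :
    φ.Holds (DBInstance.ofList l) ↔ ∀ f ∈ l, ∀ g ∈ l, φ.Admits f.1 g.1 (AgreeAt f g) := by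
  constructor
  · rintro h ⟨P, s⟩ hs ⟨Q, t⟩ ht hP hQ hX i hi
    obtain rfl : P = φ.P := hP
    obtain rfl : Q = φ.P := hQ
    exact ⟨i.2, i.2, h s hs t ht (fun i hi => (hX i hi).2.2) i hi⟩
  · intro h s hs t ht hX i hi
    exact (h _ hs _ ht rfl rfl (fun i hi => ⟨i.2, i.2, hX i hi⟩) i hi).2.2

theorem IND.holds_ofList_iff (φ : IND S) (l : List (DBFact S D N)) :
    φ.Holds (DBInstance.ofList l) ↔
      ∀ f ∈ l, f.1 = φ.Q → ∃ g ∈ l, φ.Witnesses g.1 (AgreeAt f g) := by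
  constructor
  · rintro h ⟨P, s⟩ hs hP
    obtain rfl : P = φ.Q := hP
    obtain ⟨t, ht, hst⟩ := h s hs
    exact ⟨⟨φ.P, t⟩, ht, rfl, fun k => ⟨(φ.Y k).2, (φ.X k).2, (hst k).symm⟩⟩
  · intro h s hs
    obtain ⟨⟨P, t⟩, ht, hP, hst⟩ := h _ hs rfl
    obtain rfl : P = φ.P := hP
    exact ⟨t, ht, fun k => (hst k).2.2.symm⟩

theorem FD.Admits.symm {φ : FD S} {f g : DBFact S D N} (h : φ.Admits f.1 g.1 (AgreeAt f g)) :
    φ.Admits g.1 f.1 (AgreeAt g f) := fun hg hf hX i hi =>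
  have ⟨h₁, h₂, h₃⟩ := h hf hg (fun i hi => have ⟨h₁, h₂, h₃⟩ := hX i hi; ⟨h₂, h₁, h₃.symm⟩) i hi
  ⟨h₂, h₁, h₃.symm⟩

theorem FD.admits_self (φ : FD S) (f : DBFact S D N) : φ.Admits f.1 f.1 (AgreeAt f f) := by
  rintro hP - - i -
  have hi : (i : ℕ) < S.arity f.1 := by rw [hP]; exact i.2
  exact ⟨hi, hi, rfl⟩

/-- Only pairs containing the new fact are in question, and by symmetry it may be taken as the first
component. -/
theorem FD.holds_cons_iff {φ : FD S} {l : List (DBFact S D N)} (hl : φ.Holds (DBInstance.ofList l))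
    (f : DBFact S D N) :
    φ.Holds (DBInstance.ofList (f :: l)) ↔ ∀ g ∈ l, φ.Admits f.1 g.1 (AgreeAt f g) := by
  rw [FD.holds_ofList_iff] at hl ⊢
  constructor
  · exact fun h g hg => h f (List.mem_cons_self ..) g (List.mem_cons_of_mem _ hg)
  · intro h g hg g' hg'
    rcases List.mem_cons.1 hg with rfl | h₁ <;> rcases List.mem_cons.1 hg' with rfl | h₂
    · exact φ.admits_self _
    · exact h _ h₂
    · exact (h _ h₁).symm
    · exact hl _ h₁ _ h₂

/-- Old facts keep their witnesses, and the new fact cannot be its own witness because `φ` is not a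
loop. -/
theorem IND.holds_cons_iff {φ : IND S} (hφ : φ.Q ≠ φ.P) {l : List (DBFact S D N)}
    (hl : φ.Holds (DBInstance.ofList l)) (f : DBFact S D N) :
    φ.Holds (DBInstance.ofList (f :: l)) ↔
      (f.1 = φ.Q → ∃ g ∈ l, φ.Witnesses g.1 (AgreeAt f g)) := by
  rw [IND.holds_ofList_iff] at hl ⊢
  constructor
  · intro h hf
    obtain ⟨g, hg, hfg⟩ := h f (List.mem_cons_self ..) hf
    rcases List.mem_cons.1 hg with rfl | hg
    · exact absurd (hf.symm.trans hfg.1) hφ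
    · exact ⟨g, hg, hfg⟩
  · intro h g hg hgQ
    rcases List.mem_cons.1 hg with rfl | hg
    · obtain ⟨g', hg', h'⟩ := h hgQ
      exact ⟨g', List.mem_cons_of_mem _ hg', h'⟩
    · obtain ⟨g', hg', h'⟩ := hl g hg hgQ
      exact ⟨g', List.mem_cons_of_mem _ hg', h'⟩

theorem AcyclicINDs.ne {I : Set (IND S)} (hI : AcyclicINDs I) {φ : IND S} (hφ : φ ∈ I) :
    φ.Q ≠ φ.P := fun h => hI φ.Q (.single ⟨φ, hφ, rfl, h.symm⟩)

theorem isRepair_iff_agreements {F : Set (FD S)} {I : Set (IND S)} (hI : AcyclicINDs I)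
    (l l' : List (DBFact S D N)) :
    IsRepair (Constraint.fd '' F ∪ Constraint.ind '' I) (DBInstance.ofList l)
        (DBInstance.ofList l') ↔
      (∀ f ∈ l', ∃ g ∈ l, SameFact f.1 g.1 (AgreeAt f g)) ∧
      (∀ φ ∈ F, ∀ f ∈ l', ∀ g ∈ l', φ.Admits f.1 g.1 (AgreeAt f g)) ∧
      (∀ φ ∈ I, ∀ f ∈ l', f.1 = φ.Q → ∃ g ∈ l', φ.Witnesses g.1 (AgreeAt f g)) ∧
      ∀ f ∈ l, (∃ g ∈ l', SameFact f.1 g.1 (AgreeAt f g)) ∨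
        (∃ φ ∈ F, ∃ g ∈ l', ¬ φ.Admits f.1 g.1 (AgreeAt f g)) ∨
        ∃ φ ∈ I, f.1 = φ.Q ∧ ∀ g ∈ l', ¬ φ.Witnesses g.1 (AgreeAt f g) := by
  rw [isRepair_iff hI, DBInstance.consistent_iff, and_assoc]
  simp only [sameFact_iff, ← FD.holds_ofList_iff, ← IND.holds_ofList_iff, exists_eq_right']
  refine and_congr_right fun _ => and_congr_right fun hF' => and_congr_right fun hI' =>
    forall₂_congr fun f _ => or_congr_right ?_
  rw [DBInstance.consistent_iff, not_and_or]
  push Not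
  refine or_congr (exists_congr fun φ => and_congr_right fun hφ => ?_)
    (exists_congr fun φ => and_congr_right fun hφ => ?_)
  · rw [FD.holds_cons_iff (hF' φ hφ)]
    push Not
    rfl
  · rw [IND.holds_cons_iff (hI.ne hφ) (hI' φ hφ)]
    push Not
    rfl

open StackProg

/-! ## Facts in encoded inputs -/

instance : Finite (InputSymbol S) := by
  let f : InputSymbol S → S.Rel ⊕ (Option (Fin 4) ⊕ Bool) := fun x => match x with
    | .rel P => .inl P
    | .dom => .inr (.inl none)
    | .num => .inr (.inl (some 0))
    | .bit b => .inr (.inr b)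
    | .close => .inr (.inl (some 1))
    | .sep => .inr (.inl (some 2))
  refine Finite.of_injective f fun x y h => ?_
  cases x <;> cases y <;> simp_all [f]

/-- The symbols that end a field of an encoded fact: a relation name counts as a field. -/
def InputSymbol.isEnd : InputSymbol S → Bool
  | .rel _ => true
  | .close => true
  | _ => false

section Fields

variable (encD : Computability.Encoding D Bool) (encN : Computability.Encoding N Bool)

/-- An encoded value without its end mark. -/
def valueBody (S : Schema) : D ⊕ N → List (InputSymbol S)
  | .inl d => .dom :: (encD.encode d).map .bit
  | .inr n => .num :: (encN.encode n).map .bit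

theorem encodeValue_eq (x : D ⊕ N) :
    encodeValue S encD encN x = valueBody encD encN S x ++ [.close] := by
  cases x <;> rfl

theorem valueBody_injective : Function.Injective (valueBody encD encN S) := by
  have hb : Function.Injective (InputSymbol.bit (S := S)) := fun _ _ h => by cases h; rfl
  rintro (x | x) (y | y) h
  · simp only [valueBody, List.cons.injEq, true_and] at h
    exact congrArg _ (encD.encode_injective (List.map_injective_iff.2 hb h))
  · simp [valueBody] at h
  · simp [valueBody] at h
  · simp only [valueBody, List.cons.injEq, true_and] at h
    exact congrArg _ (encN.encode_injective (List.map_injective_iff.2 hb h))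

theorem isEnd_valueBody (x : D ⊕ N) : ∀ a ∈ valueBody encD encN S x, a.isEnd = false := by
  intro a ha
  cases x <;> simp only [valueBody, List.mem_cons, List.mem_map] at ha <;>
    rcases ha with rfl | ⟨b, -, rfl⟩ <;> rfl

theorem dropField_append {A : Type} {isEnd : A → Bool} {b : List A} (hb : ∀ a ∈ b, isEnd a = false)
    {x : A} (hx : isEnd x = true) (l : List A) : dropField isEnd (b ++ x :: l) = l := by
  induction b with
  | nil => simp [dropField, hx]
  | cons a b ih =>
    simp only [List.forall_mem_cons] at hb
    simp [dropField, hb.1, ih hb.2]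

/-- The bodies contain no end mark, so neither can be a proper prefix of the other once the mark is
appended. -/
theorem sameField_append {A : Type} [DecidableEq A] {isEnd : A → Bool} {b b' : List A}
    (hb : ∀ a ∈ b, isEnd a = false) (hb' : ∀ a ∈ b', isEnd a = false)
    {x : A} (hx : isEnd x = true) (l l' : List A) :
    sameField isEnd (b ++ x :: l) (b' ++ x :: l') = true ↔ b = b' := by
  induction b generalizing b' with
  | nil =>
    cases b' with
    | nil => simp [sameField, hx]
    | cons a' b' =>
      simp only [List.forall_mem_cons] at hb'
      have : x ≠ a' := fun h => by simp [← h, hx] at hb'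
      simp [sameField, this]
  | cons a b ih =>
    simp only [List.forall_mem_cons] at hb
    cases b' with
    | nil =>
      have : a ≠ x := fun h => by simp [h, hx] at hb
      simp [sameField, this]
    | cons a' b' =>
      simp only [List.forall_mem_cons] at hb'
      by_cases h : a = a'
      · subst h
        simpa [sameField, hb.1] using ih hb.2 hb'.2
      · simp [sameField, h]

theorem iterate_dropField_values {vs : List (D ⊕ N)} {i : ℕ} (hi : i ≤ vs.length)
    (l : List (InputSymbol S)) :
    (dropField InputSymbol.isEnd)^[i] (vs.flatMap (encodeValue S encD encN) ++ l) =
      (vs.drop i).flatMap (encodeValue S encD encN) ++ l := by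
  induction i generalizing vs with
  | zero => rfl
  | succ i ih =>
    cases vs with
    | nil => simp at hi
    | cons v vs =>
      have : dropField InputSymbol.isEnd ((v :: vs).flatMap (encodeValue S encD encN) ++ l) =
          vs.flatMap (encodeValue S encD encN) ++ l := by
        rw [List.flatMap_cons, encodeValue_eq, List.append_assoc, List.append_assoc]
        exact dropField_append (isEnd_valueBody encD encN v) rfl _
      rw [Function.iterate_succ_apply, this, ih (by simpa using hi), List.drop_succ_cons]

theorem iterate_dropField_encodeFact (f : DBFact S D N) (l : List (InputSymbol S)) {i : ℕ}
    (hi : i < S.arity f.1) :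
    ∃ l', (dropField InputSymbol.isEnd)^[i + 1] (encodeFact encD encN f ++ l) =
      valueBody encD encN S (f.2.1 ⟨i, hi⟩) ++ .close :: l' := by
  have h : dropField InputSymbol.isEnd (encodeFact encD encN f ++ l) =
      (List.ofFn f.2.1).flatMap (encodeValue S encD encN) ++ l := rfl
  refine ⟨((List.ofFn f.2.1).drop (i + 1)).flatMap (encodeValue S encD encN) ++ l, ?_⟩
  rw [Function.iterate_succ_apply, h, iterate_dropField_values encD encN (by simpa using hi.le),
    List.drop_eq_getElem_cons (by simpa using hi), List.flatMap_cons, encodeValue_eq,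
    List.getElem_ofFn]
  simp

/-- The entries number `i` and `j` agree; the relation names are fields number `0`. -/
def EntriesAgree {m : ℕ} (E : Agreement m) (i j : ℕ) : Prop :=
  ∃ (hi : i + 1 < m) (hj : j + 1 < m), (⟨i + 1, hi⟩, ⟨j + 1, hj⟩) ∈ E

/-- The rests `l` and `l'` are arbitrary: fields within the arities never reach beyond the leading
facts. -/
theorem entriesAgree_agreement [DecidableEq (InputSymbol S)] {m : ℕ} (hm : ∀ P, S.arity P < m)
    (f g : DBFact S D N) (l l' : List (InputSymbol S)) {i j : ℕ} (hi : i < S.arity f.1)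
    (hj : j < S.arity g.1) :
    EntriesAgree (agreement InputSymbol.isEnd m (encodeFact encD encN f ++ l)
      (encodeFact encD encN g ++ l')) i j ↔ AgreeAt f g i j := by
  have hi' : i + 1 < m := by have := hm f.1; omega
  have hj' : j + 1 < m := by have := hm g.1; omega
  obtain ⟨r, hr⟩ := iterate_dropField_encodeFact encD encN f l hi
  obtain ⟨r', hr'⟩ := iterate_dropField_encodeFact encD encN g l' hj
  have h : sameField InputSymbol.isEnd
      ((dropField InputSymbol.isEnd)^[i + 1] (encodeFact encD encN f ++ l))
      ((dropField InputSymbol.isEnd)^[j + 1] (encodeFact encD encN g ++ l')) = true ↔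
      f.2.1 ⟨i, hi⟩ = g.2.1 ⟨j, hj⟩ := by
    rw [hr, hr', sameField_append (isEnd_valueBody encD encN _) (isEnd_valueBody encD encN _) rfl,
      (valueBody_injective encD encN).eq_iff]
  simp only [EntriesAgree, AgreeAt, agreement, Set.mem_ofPred_eq, h, hi', hj', hi, hj,
    exists_true_left]

end Fields

/-- Beyond the arity, fields of a suffix run into the following text and their agreements are
meaningless. Hence only positions within the arities are compared. -/
theorem SameFact.congr {P Q : S.Rel} {E E' : ℕ → ℕ → Prop}
    (h : ∀ i < S.arity P, ∀ j < S.arity Q, (E i j ↔ E' i j)) : SameFact P Q E ↔ SameFact P Q E' := by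
  refine and_congr_right fun hPQ => forall₂_congr fun i hi => h i hi i (hPQ ▸ hi)

theorem FD.Admits.congr (φ : FD S) {P Q : S.Rel} {E E' : ℕ → ℕ → Prop}
    (h : ∀ i < S.arity P, ∀ j < S.arity Q, (E i j ↔ E' i j)) : φ.Admits P Q E ↔ φ.Admits P Q E' := by
  refine forall₂_congr fun hP hQ => ?_
  subst hP hQ
  exact imp_congr (forall₂_congr fun i _ => h i i.2 i i.2) (forall₂_congr fun i _ => h i i.2 i i.2)

theorem IND.Witnesses.congr (φ : IND S) {P Q : S.Rel} (hP : P = φ.Q) {E E' : ℕ → ℕ → Prop}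
    (h : ∀ i < S.arity P, ∀ j < S.arity Q, (E i j ↔ E' i j)) :
    φ.Witnesses Q E ↔ φ.Witnesses Q E' := by
  refine and_congr_right fun hQ => forall_congr' fun k => ?_
  subst hP hQ
  exact h _ (φ.Y k).2 _ (φ.X k).2

/-! ### Facts as suffixes of the encoded input -/

section Suffixes

variable (encD : Computability.Encoding D Bool) (encN : Computability.Encoding N Bool)

theorem suffix_append_cases {A : Type} {u v w : List A} (h : u <:+ v ++ w) :
    u <:+ w ∨ ∃ s, s ≠ [] ∧ s <:+ v ∧ u = s ++ w := by
  obtain ⟨c, hc⟩ := h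
  rcases List.append_eq_append_iff.1 hc with ⟨a, h, hu⟩ | ⟨a, -, h⟩
  · rcases eq_or_ne a [] with rfl | ha
    · exact Or.inl (by simp [hu])
    · exact Or.inr ⟨a, ha, ⟨c, h.symm⟩, hu⟩
  · exact Or.inl ⟨a, h.symm⟩

theorem rel_notMem_values (vs : List (D ⊕ N)) (P : S.Rel) :
    InputSymbol.rel P ∉ vs.flatMap (encodeValue S encD encN) := by
  intro h
  obtain ⟨x, -, hx⟩ := List.mem_flatMap.1 h
  cases x <;> simp [encodeValue] at hx

theorem sep_notMem_encodeFacts (l : List (DBFact S D N)) :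
    InputSymbol.sep ∉ l.flatMap (encodeFact encD encN) := by
  intro h
  obtain ⟨f, -, hf⟩ := List.mem_flatMap.1 h
  rw [encodeFact, List.mem_cons] at hf
  obtain ⟨x, -, hx⟩ := List.mem_flatMap.1 (hf.resolve_left (by simp))
  cases x <;> simp [encodeValue] at hx

/-- Relation symbols never occur inside values, so one can only be the first symbol of an encoded
fact. -/
theorem exists_fact_of_suffix {l : List (DBFact S D N)} {u : List (InputSymbol S)}
    (hu : u <:+ l.flatMap (encodeFact encD encN)) {P : S.Rel} (hP : u.head? = some (.rel P)) :
    ∃ f ∈ l, f.1 = P ∧ ∃ r, u = encodeFact encD encN f ++ r := by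
  induction l with
  | nil => simp [List.suffix_nil.1 hu] at hP
  | cons f l ih =>
    rw [List.flatMap_cons] at hu
    rcases suffix_append_cases hu with hu | ⟨s, hs, hsf, rfl⟩
    · obtain ⟨g, hg, h⟩ := ih hu
      exact ⟨g, List.mem_cons_of_mem _ hg, h⟩
    · obtain ⟨x, s, rfl⟩ := List.exists_cons_of_ne_nil hs
      rw [List.cons_append, List.head?_cons, Option.some.injEq] at hP
      subst hP
      rcases List.suffix_cons_iff.1 hsf with h | h
      · refine ⟨f, List.mem_cons_self .., ?_, _, congrArg (· ++ _) h⟩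
        exact (InputSymbol.rel.inj (List.cons.inj h).1).symm
      · exact absurd (h.subset (List.mem_cons_self ..)) (rel_notMem_values encD encN _ P)

/-- The list of facts before the separator, for `true`, or after it. -/
def factsOn (p : List (DBFact S D N) × List (DBFact S D N)) : Bool → List (DBFact S D N)
  | true => p.1
  | false => p.2

variable [DecidableEq (InputSymbol S)]

theorem exists_suffix_of_fact (p : List (DBFact S D N) × List (DBFact S D N)) {b : Bool}
    {f : DBFact S D N} (hf : f ∈ factsOn p b) :
    ∃ r, encodeFact encD encN f ++ r ∈ suffixes (encodePair encD encN p) ∧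
      desc InputSymbol.sep (encodeFact encD encN f ++ r) = (some (.rel f.1), b) := by
  cases b with
  | true =>
    obtain ⟨a, c, h⟩ := List.append_of_mem (show f ∈ p.1 from hf)
    refine ⟨c.flatMap (encodeFact encD encN) ++ .sep :: p.2.flatMap (encodeFact encD encN),
      ⟨by simp [encodeFact], a.flatMap (encodeFact encD encN), by simp [encodePair, h]⟩, ?_⟩
    simp [desc, encodeFact]
  | false =>
    obtain ⟨a, c, h⟩ := List.append_of_mem (show f ∈ p.2 from hf)
    refine ⟨c.flatMap (encodeFact encD encN), ⟨by simp [encodeFact],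
      p.1.flatMap (encodeFact encD encN) ++ .sep :: a.flatMap (encodeFact encD encN),
      by simp [encodePair, h]⟩, ?_⟩
    have := sep_notMem_encodeFacts encD encN (f :: c)
    rw [List.flatMap_cons] at this
    simp only [desc, this, decide_false]
    rfl

/-- A suffix beginning with a relation name contains the separator exactly when it begins in the
first list. -/
theorem exists_fact_of_desc (p : List (DBFact S D N) × List (DBFact S D N)) {b : Bool}
    {u : List (InputSymbol S)} (hu : u ∈ suffixes (encodePair encD encN p)) {P : S.Rel}
    (hd : desc InputSymbol.sep u = (some (.rel P), b)) :
    ∃ f ∈ factsOn p b, f.1 = P ∧ ∃ r, u = encodeFact encD encN f ++ r := by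
  obtain ⟨hP, hb⟩ := Prod.mk.inj hd
  rcases suffix_append_cases hu.2 with h | ⟨s, hs, hsp, rfl⟩
  · rcases List.suffix_cons_iff.1 h with rfl | h
    · simp at hP
    · have : InputSymbol.sep ∉ u := fun hm => sep_notMem_encodeFacts encD encN _ (h.subset hm)
      obtain rfl : b = false := by simpa [this] using hb.symm
      exact exists_fact_of_suffix encD encN h hP
  · obtain rfl : b = true := by simpa using hb.symm
    obtain ⟨f, hf, hfP, r, rfl⟩ := exists_fact_of_suffix encD encN hsp (P := P)
      (by rwa [List.head?_append_of_ne_nil _ hs] at hP)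
    exact ⟨f, hf, hfP, _, List.append_assoc ..⟩

end Suffixes

/-- All entries for relation names on the side `b` satisfy `Φ`. -/
def AllOn {β : Type} (b : Bool) (T : Set (Desc (InputSymbol S) × β)) (Φ : S.Rel → β → Prop) : Prop :=
  ∀ t ∈ T, ∀ P, t.1 = (some (.rel P), b) → Φ P t.2

/-- Some entry for a relation name on the side `b` satisfies `Φ`. -/
def SomeOn {β : Type} (b : Bool) (T : Set (Desc (InputSymbol S) × β)) (Φ : S.Rel → β → Prop) :
    Prop :=
  ∃ t ∈ T, ∃ P, t.1 = (some (.rel P), b) ∧ Φ P t.2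

section Quantifiers

variable (encD : Computability.Encoding D Bool) (encN : Computability.Encoding N Bool)
  [DecidableEq (InputSymbol S)]

/-- Since `hΦ` makes `Φ` blind to the text after the leading fact, quantifying over suffixes is
quantifying over facts. Taking `β` arbitrary allows use at both levels of a type. -/
theorem allOn_image_suffixes {β : Type} (p : List (DBFact S D N) × List (DBFact S D N)) (b : Bool)
    (h : List (InputSymbol S) → β) {Φ : S.Rel → β → Prop} {Ψ : DBFact S D N → Prop}
    (hΦ : ∀ f r, Φ f.1 (h (encodeFact encD encN f ++ r)) ↔ Ψ f) :
    AllOn b ((fun u => (desc InputSymbol.sep u, h u)) '' suffixes (encodePair encD encN p)) Φ ↔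
      ∀ f ∈ factsOn p b, Ψ f := by
  constructor
  · intro H f hf
    obtain ⟨r, hr, hd⟩ := exists_suffix_of_fact encD encN p hf
    exact (hΦ f r).1 (H _ (Set.mem_image_of_mem _ hr) _ hd)
  · rintro H _ ⟨u, hu, rfl⟩ P hd
    obtain ⟨f, hf, rfl, r, rfl⟩ := exists_fact_of_desc encD encN p hu hd
    exact (hΦ f r).2 (H f hf)

theorem someOn_image_suffixes {β : Type} (p : List (DBFact S D N) × List (DBFact S D N)) (b : Bool)
    (h : List (InputSymbol S) → β) {Φ : S.Rel → β → Prop} {Ψ : DBFact S D N → Prop}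
    (hΦ : ∀ f r, Φ f.1 (h (encodeFact encD encN f ++ r)) ↔ Ψ f) :
    SomeOn b ((fun u => (desc InputSymbol.sep u, h u)) '' suffixes (encodePair encD encN p)) Φ ↔
      ∃ f ∈ factsOn p b, Ψ f := by
  constructor
  · rintro ⟨_, ⟨u, hu, rfl⟩, P, hd, H⟩
    obtain ⟨f, hf, rfl, r, rfl⟩ := exists_fact_of_desc encD encN p hu hd
    exact ⟨f, hf, (hΦ f r).1 H⟩
  · rintro ⟨f, hf, H⟩
    obtain ⟨r, hr, hd⟩ := exists_suffix_of_fact encD encN p hf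
    exact ⟨_, Set.mem_image_of_mem _ hr, _, hd, (hΦ f r).2 H⟩

end Quantifiers

/-- The criterion for repairs, read off the type of the encoded input. -/
def RepairType (F : Set (FD S)) (I : Set (IND S)) {m : ℕ}
    (T : Set (Desc (InputSymbol S) × Set (Desc (InputSymbol S) × Agreement m))) : Prop :=
  AllOn false T (fun P s => SomeOn true s fun Q E => SameFact P Q (EntriesAgree E)) ∧
  (∀ φ ∈ F, AllOn false T fun P s => AllOn false s fun Q E => φ.Admits P Q (EntriesAgree E)) ∧
  (∀ φ ∈ I, AllOn false T fun P s => P = φ.Q →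
    SomeOn false s fun Q E => φ.Witnesses Q (EntriesAgree E)) ∧
  AllOn true T fun P s => (SomeOn false s fun Q E => SameFact P Q (EntriesAgree E)) ∨
    (∃ φ ∈ F, SomeOn false s fun Q E => ¬ φ.Admits P Q (EntriesAgree E)) ∨
    ∃ φ ∈ I, P = φ.Q ∧ AllOn false s fun Q E => ¬ φ.Witnesses Q (EntriesAgree E)

theorem theoremt (S : Schema) (D N : Type)
    (encD : Computability.Encoding D Bool) (encN : Computability.Encoding N Bool)
    (F : Set (FD S)) (I : Set (IND S)) (hI : AcyclicINDs I) :
    RepairCheckingInPTIME S encD encN (Constraint.fd '' F ∪ Constraint.ind '' I) := by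
  classical
  have : Fintype (InputSymbol S) := Fintype.ofFinite _
  -- One field more than the largest arity, since the relation name occupies field 0.
  let m := Finset.univ.sup S.arity + 1
  have hm : ∀ P, S.arity P < m := fun P =>
    Nat.lt_succ_of_le (Finset.le_sup (f := S.arity) (Finset.mem_univ P))
  refine decidableInPolyTime_of_wordType _ _ InputSymbol.isEnd .sep m (RepairType F I) fun p => ?_
  refine (isRepair_iff_agreements hI p.1 p.2).trans (Iff.symm ?_)
  have hE : ∀ (f g : DBFact S D N) r r' , ∀ i < S.arity f.1, ∀ j < S.arity g.1,
      (EntriesAgree (agreement InputSymbol.isEnd m (encodeFact encD encN f ++ r)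
        (encodeFact encD encN g ++ r')) i j ↔ AgreeAt f g i j) := fun f g r r' i hi j hj =>
    entriesAgree_agreement encD encN hm f g r r' hi hj
  refine and_congr ?_ (and_congr ?_ (and_congr ?_ ?_))
  · exact allOn_image_suffixes encD encN p false _ fun f r =>
      someOn_image_suffixes encD encN p true _ fun g r' => SameFact.congr (hE f g r r')
  · exact forall₂_congr fun φ _ => allOn_image_suffixes encD encN p false _ fun f r =>
      allOn_image_suffixes encD encN p false _ fun g r' => FD.Admits.congr φ (hE f g r r')
  · exact forall₂_congr fun φ _ => allOn_image_suffixes encD encN p false _ fun f r =>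
      forall_congr' fun hf => someOn_image_suffixes encD encN p false _ fun g r' =>
        IND.Witnesses.congr φ hf (hE f g r r')
  · exact allOn_image_suffixes encD encN p true _ fun f r => or_congr
      (someOn_image_suffixes encD encN p false _ fun g r' => SameFact.congr (hE f g r r'))
      (or_congr
        (exists_congr fun φ => and_congr_right fun _ => someOn_image_suffixes encD encN p false _
          fun g r' => not_congr (FD.Admits.congr φ (hE f g r r')))
        (exists_congr fun φ => and_congr_right fun _ => and_congr_right fun hf =>
          allOn_image_suffixes encD encN p false _
            fun g r' => not_congr (IND.Witnesses.congr φ hf (hE f g r r'))))
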